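/- Let $L\ge 1$, let $V=(V_1,\dots,V_K)$ be an ordered set of $K$ distinct elements of $\mathbb{Z}_L$ (the non-deletions), let $\xi$ be a probability distribution on $\mathbb{Z}_L$, and let $P_X$ be a probability distribution (prior) on the signals $\mathbb{Z}_2^L$ whose support $\mathcal{X}$ has at least two elements. For $p\in[0,1]$ and a signal $x\in\mathbb{Z}_2^L$ let $\mu_x$ denote the law on $\mathbb{Z}_2^K$ of $Y(j)=x(S+V_j)\oplus Z(j)$, $1\le j\le K$, where the shift $S\sim\xi$ and the noise $Z\sim\mathrm{Ber}(p)^K$ are independent, and the index $S+V_j$ is taken mod $L$. Put $\mathrm{SNR}=(p-\frac12)^2$. A signal $X\sim P_X$ is estimated from observations $Y_1,\dots,Y_N$ which, given $X=x$, are i.i.d. with law $\mu_x$; let $P_e=P(\hat X\ne X)$ be the probability of error of a maximum a posteriori (MAP) estimator $\hat X$. For probability distributions $\mu,\nu$ on a finite set let $$C(\mu,\nu)=-\inf_{0\le\lambda\le1}\log\sum_y\mu(y)^\lambda\nu(y)^{1-\lambda}\in[0,\infty]$$ be their Chernoff information. For $\mathbf{k}=(k_1,\dots,k_d)\in\mathbb{Z}_L^d$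 let $A_{\xi,\mathbf{k}}(x)=\sum_{s\in\mathbb{Z}_L}\xi(s)\,x(k_1+s)\cdots x(k_d+s)$, where the entries of $x$ are read as the real numbers $0,1$. Let $V^d$ be the set of vectors of length $d$ with entries in $V$, and let $$t_{\xi,V}(x_1,x_2)=\inf\{d: A_{\xi,\mathbf{k}}(x_1)\ne A_{\xi,\mathbf{k}}(x_2)\text{ for some }\mathbf{k}\in V^d\}.$$ 1. For every $p\in[0,1]$ and every choice of MAP estimators, $$\lim_{N\to\infty}\frac1N\log P_e=-\min_{\substack{x_1,x_2\in\mathcal{X}\\x_1\ne x_2}}C(\mu_{x_1},\mu_{x_2}),$$ as an identity in $[-\infty,0]$, with $\log 0=-\infty$. 2. For all distinct $x_1,x_2\in\mathcal{X}$ such that $t=t_{\xi,V}(x_1,x_2)$ is finite, as $\mathrm{SNR}\to0$ with $L,V,\xi,x_1,x_2$ fixed, $$C(\mu_{x_1},\mu_{x_2})=\frac{2^{4t-3}}{t!}\,\mathrm{SNR}^t\sum_{\mathbf{k}\in V^t}\bigl(A_{\xi,\mathbf{k}}(x_1)-A_{\xi,\mathbf{k}}(x_2)\bigr)^2+O(\mathrm{SNR}^{t+1}).$$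 -/

import Mathlib

open MeasureTheory ProbabilityTheory Filter Topology Asymptotics
open scoped ENNReal unitInterval

namespace BMA

noncomputable section

/-- Boolean signals of length `L`, indexed cyclically. -/
abbrev Signal (L : ℕ) : Type := ZMod L → ZMod 2

/-- Boolean observations of length `K`. -/
abbrev Obs (K : ℕ) : Type := Fin K → ZMod 2

/-- The law `Ber(p)` of one noise bit: `1` with probability `p`, and `0` with probability `1 - p`. -/
def noiseBit (p : I) : Measure (ZMod 2) := bernoulliMeasure 1 0 p

/-- The law `Ber(p)^K` of the noise vector `Z`. -/
def noiseLaw (K : ℕ) (p : I) : Measure (Obs K) := Measure.pi fun _ => noiseBit p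

/-- The signal-to-noise ratio `(p - 1/2)^2`. -/
def snr (p : I) : ℝ := ((p : ℝ) - 1 / 2) ^ 2

/-- The noiseless observation `j ↦ x (s + V_j)` of the signal `x` under the shift `s`,
where `V = (V_0, …, V_{K-1})` is the ordered set of non-deletions. -/
def shiftedCopy {L K : ℕ} (V : Fin K ↪ ZMod L) (x : Signal L) (s : ZMod L) : Obs K :=
  fun j => x (s + V j)

/-- `μ_x`: the conditional law given the signal `x` of an observation `Y(j) = x(S + V_j) ⊕ Z(j)`,
with `S ∼ ξ` and `Z ∼ Ber(p)^K` independent. -/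
def obsLaw {L K : ℕ} (V : Fin K ↪ ZMod L) (ξ : PMF (ZMod L)) (p : I) (x : Signal L) :
    Measure (Obs K) :=
  (ξ.toMeasure.prod (noiseLaw K p)).map fun sz => shiftedCopy V x sz.1 + sz.2

/-- The conditional law given the signal `x` of `N` independent observations `Y_1, …, Y_N`. -/
def sampleLaw {L K : ℕ} (V : Fin K ↪ ZMod L) (ξ : PMF (ZMod L)) (p : I) (N : ℕ) (x : Signal L) :
    Measure (Fin N → Obs K) :=
  Measure.pi fun _ => obsLaw V ξ p x

/-- `g` is a maximum a posteriori rule for `N` observations and the prior `π`: on every sample `y`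
its answer maximizes the joint probability of `(x, y)` over the signals `x`, hence the posterior
probability of `x` whenever `y` has positive probability. -/
def IsMAP {L K : ℕ} (V : Fin K ↪ ZMod L) (ξ : PMF (ZMod L)) (p : I) (π : PMF (Signal L)) (N : ℕ)
    (g : (Fin N → Obs K) → Signal L) : Prop :=
  ∀ (y : Fin N → Obs K) (x : Signal L),
    π x * sampleLaw V ξ p N x {y} ≤ π (g y) * sampleLaw V ξ p N (g y) {y}

/-- The probability of error `P(X̂ ≠ X) = ∑ₓ P(X̂ ≠ x | X = x) P_X(x)` of the rule `g`. -/
def errorProb {L K : ℕ} [NeZero L] (V : Fin K ↪ ZMod L) (ξ : PMF (ZMod L)) (p : I)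
    (π : PMF (Signal L)) (N : ℕ) (g : (Fin N → Obs K) → Signal L) : ℝ≥0∞ :=
  ∑ x : Signal L, sampleLaw V ξ p N x {y | g y ≠ x} * π x

/-- The Chernoff information `-inf_{0 ≤ l ≤ 1} log ∑_y μ(y)^l ν(y)^(1-l)` of two laws on a finite
space. It is `⊤` exactly when the sum vanishes for some `l`, as for disjoint supports. -/
def chernoffInfo {α : Type*} [Fintype α] [MeasurableSpace α] (μ ν : Measure α) : EReal :=
  -⨅ l ∈ Set.Icc (0 : ℝ) 1, ENNReal.log (∑ y : α, μ {y} ^ l * ν {y} ^ (1 - l))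

/-- The `(ξ, k)`-autocorrelation `∑ₛ ξ(s) x(k_1 + s) ⋯ x(k_d + s)`, of order `d`, with the entries
of `x` read as the real numbers `0` and `1`. -/
def autocorr {L : ℕ} [NeZero L] (ξ : PMF (ZMod L)) {d : ℕ} (k : Fin d → ZMod L) (x : Signal L) :
    ℝ :=
  ∑ s : ZMod L, (ξ s).toReal * ∏ i : Fin d, ((x (k i + s)).val : ℝ)

/-- `V^d`: the vectors of length `d` with entries in `V`. -/
def tuples {L K : ℕ} (V : Fin K ↪ ZMod L) (d : ℕ) : Finset (Fin d → ZMod L) :=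
  Fintype.piFinset fun _ => Finset.univ.map V

/-- `t_{ξ,V}(x₁, x₂)`: the infimum of the orders `d` for which some `k ∈ V^d` has
`A_{ξ,k}(x₁) ≠ A_{ξ,k}(x₂)`; it is `⊤` if there is none. -/
def sepOrder {L K : ℕ} [NeZero L] (V : Fin K ↪ ZMod L) (ξ : PMF (ZMod L)) (x₁ x₂ : Signal L) : ℕ∞ :=
  ⨅ d ∈ {d : ℕ | ∃ k ∈ tuples V d, autocorr ξ k x₁ ≠ autocorr ξ k x₂}, (d : ℕ∞)

end

end BMA

/-! Part 1. Up to factors independent of `N`, the MAP error is the sum over pairs of signals of the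
overlaps `∑ min(P^N, Q^N)` of the product laws: any rule errs on one of two signals
(`le_errorProb`), and a MAP rule pays at most the smaller likelihood (`errorProb_le`). The upper
bound on an overlap is `min a b ≤ a^l b^(1-l)`, which factorizes. For the lower bound, tilt to the
law proportional to `P^l Q^(1-l)` at a minimizing `l`. By the first-order condition the mean
log-likelihood ratio is zero there, or has the harmless sign if `l` is an endpoint, so by Chebyshev
both products are at least `F^N exp(-εN)` times the tilted one on a set of tilted mass at least 1/2
(`exists_affinity_lower_bound`). The finitely many pairs leave the worst exponent.

Part 2. Put `θ = 1 - 2p`, so `SNR = θ²/4`. The Walsh expansion of the observation law carries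
`θ^|A|` on the character of `A`, with coefficients triangular in the autocorrelations. Hence two
laws first differ at degree `t`: they are `b + θ^t d` and `b`. Expanding the Chernoff sum gives `1 -
l(1-l)/2 · θ^(2t) ∑ d²/b` with an error uniform in `l`. The order `2t+1` is absent because `θ ↦ -θ`
amounts to complementing all bits, which only permutes the alphabet. The extremal `l` is 1/2 to
leading order, and Parseval evaluates `∑ d²/b` (`exists_iInf_log_eq`, `exists_chernoffInfo_eq`). -/

namespace BMA

/-! ### Chebyshev's inequality over a finite alphabet. -/

section Concentration

variable {α : Type*} [Fintype α]

/-- Second moment of an i.i.d. sum of a centred function, shifted by `z`. -/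
lemma sum_prod_mul_add_sum_sq (q w : α → ℝ) (hq : ∑ a, q a = 1) (hw : ∑ a, q a * w a = 0)
    (N : ℕ) (z : ℝ) :
    ∑ y : Fin N → α, (∏ i, q (y i)) * (z + ∑ i, w (y i)) ^ 2 =
      z ^ 2 + N * ∑ a, q a * w a ^ 2 := by
  -- The shift `z` absorbs the first letter; its cross term vanishes because `w` is centred.
  induction N generalizing z with
  | zero => simp
  | succ n ih =>
    rw [← (Fin.consEquiv fun _ : Fin (n + 1) => α).sum_comp, Fintype.sum_prod_type]
    have h : ∀ a : α, ∑ y : Fin n → α,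
        (∏ i, q (Fin.consEquiv (fun _ : Fin (n + 1) => α) (a, y) i)) *
          (z + ∑ i, w (Fin.consEquiv (fun _ : Fin (n + 1) => α) (a, y) i)) ^ 2 =
        z ^ 2 * q a + 2 * z * (q a * w a) + q a * w a ^ 2 +
          (n * ∑ b, q b * w b ^ 2) * q a := by
      intro a
      simp only [Fin.consEquiv_apply, Fin.prod_univ_succ, Fin.sum_univ_succ, Fin.cons_zero,
        Fin.cons_succ, mul_assoc, ← Finset.mul_sum, ← add_assoc]
      rw [ih]
      ring
    simp only [h, Finset.sum_add_distrib, ← Finset.mul_sum, hq, hw]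
    push_cast
    ring

lemma sum_prod_eq_one (q : α → ℝ) (hq : ∑ a, q a = 1) (N : ℕ) :
    ∑ y : Fin N → α, ∏ i, q (y i) = 1 := by
  rw [← Fintype.sum_pow, hq, one_pow]

/-- Chebyshev's inequality for i.i.d. sums over a finite alphabet. -/
lemma one_sub_le_sum_prod_filter (q ℓ : α → ℝ) (hq0 : ∀ a, 0 ≤ q a) (hq : ∑ a, q a = 1)
    {ε : ℝ} (hε : 0 < ε) {N : ℕ} (hN : 0 < N) :
    1 - (∑ a, q a * (ℓ a - ∑ b, q b * ℓ b) ^ 2) / (ε ^ 2 * N) ≤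
      ∑ y : Fin N → α with |(∑ i, ℓ (y i)) - N * ∑ b, q b * ℓ b| ≤ ε * N, ∏ i, q (y i) := by
  set m := ∑ b, q b * ℓ b with hm
  have hw : ∑ a, q a * (ℓ a - m) = 0 := by
    simp only [mul_sub, Finset.sum_sub_distrib, ← Finset.sum_mul, hq, one_mul]
    rw [← hm, sub_self]
  have key := sum_prod_mul_add_sum_sq q (fun a => ℓ a - m) hq hw N 0
  have hsum : ∀ y : Fin N → α, 0 + ∑ i, (ℓ (y i) - m) = (∑ i, ℓ (y i)) - N * m := by
    intro y
    simp [Finset.sum_sub_distrib]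
  simp only [hsum] at key
  have hNpos : (0 : ℝ) < N := by exact_mod_cast hN
  have hsplit := Finset.sum_filter_add_sum_filter_not Finset.univ
    (fun y : Fin N → α => |(∑ i, ℓ (y i)) - N * m| ≤ ε * N) (fun y => ∏ i, q (y i))
  rw [sum_prod_eq_one q hq] at hsplit
  have hbad : (ε * N) ^ 2 * ∑ y : Fin N → α with ¬ |(∑ i, ℓ (y i)) - N * m| ≤ ε * N,
      ∏ i, q (y i) ≤ N * ∑ a, q a * (ℓ a - m) ^ 2 := by
    rw [zero_pow two_ne_zero, zero_add] at key
    rw [← key, Finset.mul_sum]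
    refine (Finset.sum_le_sum fun y hy => ?_).trans
      (Finset.sum_le_univ_sum_of_nonneg fun y => ?_)
    · have hlt := not_le.1 (Finset.mem_filter.1 hy).2
      rw [mul_comm]
      refine mul_le_mul_of_nonneg_left ?_ (Finset.prod_nonneg fun i _ => hq0 _)
      rw [← sq_abs ((∑ i, ℓ (y i)) - N * m)]
      exact pow_le_pow_left₀ (by positivity) hlt.le 2
    · exact mul_nonneg (Finset.prod_nonneg fun i _ => hq0 _) (sq_nonneg _)
  have hb : ∑ y : Fin N → α with ¬ |(∑ i, ℓ (y i)) - N * m| ≤ ε * N, ∏ i, q (y i) ≤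
      (∑ a, q a * (ℓ a - m) ^ 2) / (ε ^ 2 * N) := by
    rw [le_div_iff₀ (by positivity)]
    refine le_of_mul_le_mul_left ?_ hNpos
    calc _ = _ := by ring
      _ ≤ _ := hbad
  linarith

end Concentration

/-! ### Lower bound on the overlap by exponential tilting. -/

section Tilting

variable {α : Type*} [Fintype α]

/-- The Chernoff sum `∑ P^l Q^(1-l)` over the common support of `P` and `Q`. -/
noncomputable def affinity (P Q : α → ℝ) (l : ℝ) : ℝ :=
  ∑ a with P a ≠ 0 ∧ Q a ≠ 0, P a ^ l * Q a ^ (1 - l)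

lemma hasDerivAt_affinity {P Q : α → ℝ} (hP : ∀ a, 0 ≤ P a) (hQ : ∀ a, 0 ≤ Q a) (l : ℝ) :
    HasDerivAt (affinity P Q) (∑ a with P a ≠ 0 ∧ Q a ≠ 0,
      P a ^ l * Q a ^ (1 - l) * (Real.log (P a) - Real.log (Q a))) l := by
  unfold affinity
  refine HasDerivAt.fun_sum fun a ha => ?_
  obtain ⟨hPa, hQa⟩ := (Finset.mem_filter.1 ha).2
  have hP' := (hP a).lt_of_ne' hPa
  have hQ' := (hQ a).lt_of_ne' hQa
  have h := (Real.hasStrictDerivAt_const_rpow hP' l).hasDerivAt.mul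
    (HasDerivAt.const_rpow (hQ') ((hasDerivAt_id l).const_sub 1))
  refine h.congr_deriv ?_
  simp
  ring

/-- A minimizer of the Chernoff sum with its first-order condition. -/
lemma exists_affinity_min {P Q : α → ℝ} (hP : ∀ a, 0 ≤ P a) (hQ : ∀ a, 0 ≤ Q a) :
    ∃ l ∈ Set.Icc (0 : ℝ) 1, ∀ D, HasDerivAt (affinity P Q) D l → 0 ≤ (1 - l) * D ∧ l * D ≤ 0 := by
  have hc : ContinuousOn (affinity P Q) (Set.Icc 0 1) := fun l _ =>
    (hasDerivAt_affinity hP hQ l).continuousAt.continuousWithinAt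
  obtain ⟨l, hl, hmin⟩ := isCompact_Icc.exists_isMinOn (Set.nonempty_Icc.2 zero_le_one) hc
  refine ⟨l, hl, fun D hD => ?_⟩
  -- The derivative at a minimizer is nonnegative towards every point of the interval; `z = 1` and
  -- `z = 0` give the two claims.
  have key : ∀ z ∈ Set.Icc (0 : ℝ) 1, 0 ≤ (z - l) * D := by
    intro z hz
    have := hmin.localize.hasFDerivWithinAt_nonneg hD.hasFDerivAt.hasFDerivWithinAt
      (sub_mem_posTangentConeAt_of_segment_subset ((convex_Icc (0 : ℝ) 1).segment_subset hl hz))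
    simpa using this
  refine ⟨key 1 (by simp), ?_⟩
  have := key 0 (by simp)
  linarith

/-- Chernoff's lower bound: the overlap of the `N`-fold products decays no faster than the least
Chernoff sum. -/
lemma exists_affinity_lower_bound {P Q : α → ℝ} (hP : ∀ a, 0 ≤ P a) (hQ : ∀ a, 0 ≤ Q a)
    (hne : ∃ a, P a ≠ 0 ∧ Q a ≠ 0) :
    ∃ l ∈ Set.Icc (0 : ℝ) 1, 0 < affinity P Q l ∧ ∀ ε > 0, ∀ᶠ N : ℕ in atTop,
      1 / 2 * (affinity P Q l ^ N * Real.exp (-(ε * N))) ≤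
        ∑ y : Fin N → α, min (∏ i, P (y i)) (∏ i, Q (y i)) := by
  obtain ⟨l, hl, hD⟩ := exists_affinity_min hP hQ
  obtain ⟨a₀, ha₀⟩ := hne
  have hpos : 0 < affinity P Q l := by
    refine Finset.sum_pos (fun a ha => ?_) ⟨a₀, by simpa using ha₀⟩
    obtain ⟨hPa, hQa⟩ := (Finset.mem_filter.1 ha).2
    have hP' := (hP a).lt_of_ne' hPa
    have hQ' := (hQ a).lt_of_ne' hQa
    positivity
  refine ⟨l, hl, hpos, fun ε hε => ?_⟩
  obtain ⟨hD1, hD0⟩ := hD _ (hasDerivAt_affinity hP hQ l)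
  set F := affinity P Q l with hF
  -- `ℓ` is the log-likelihood ratio and `q` the tilted law; on the common support `P = F q
  -- exp((1-l)ℓ)` and `Q = F q exp(-lℓ)`.
  set ℓ : α → ℝ := fun a => Real.log (P a) - Real.log (Q a) with hℓ
  set q : α → ℝ := fun a => if P a ≠ 0 ∧ Q a ≠ 0 then P a ^ l * Q a ^ (1 - l) / F else 0 with hqdef
  have hq0 : ∀ a, 0 ≤ q a := by
    intro a
    simp only [hqdef]
    split_ifs
    · exact div_nonneg (mul_nonneg (Real.rpow_nonneg (hP a) _) (Real.rpow_nonneg (hQ a) _)) hpos.le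
    · exact le_rfl
  have hq1 : ∑ a, q a = 1 := by
    simp only [hqdef, ← Finset.sum_filter, ← Finset.sum_div]
    exact div_self hpos.ne'
  have hm : ∑ a, q a * ℓ a = (∑ a with P a ≠ 0 ∧ Q a ≠ 0,
      P a ^ l * Q a ^ (1 - l) * (Real.log (P a) - Real.log (Q a))) / F := by
    simp only [hqdef, ite_mul, zero_mul, ← Finset.sum_filter, Finset.sum_div, hℓ]
    refine Finset.sum_congr rfl fun a _ => ?_
    ring
  set m := ∑ a, q a * ℓ a with hmdef
  have hm1 : 0 ≤ (1 - l) * m := by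
    rw [hm, ← mul_div_assoc]
    exact div_nonneg hD1 hpos.le
  have hm0 : l * m ≤ 0 := by
    rw [hm, ← mul_div_assoc]
    exact div_nonpos_of_nonpos_of_nonneg hD0 hpos.le
  have hPq : ∀ a, F * q a * Real.exp ((1 - l) * ℓ a) ≤ P a := by
    intro a
    simp only [hqdef]
    split_ifs with h
    · have hP' := (hP a).lt_of_ne' h.1
      have hQ' := (hQ a).lt_of_ne' h.2
      rw [mul_div_cancel₀ _ hpos.ne', Real.rpow_def_of_pos hP', Real.rpow_def_of_pos hQ',
        ← Real.exp_add, ← Real.exp_add]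
      refine (Eq.trans (congrArg Real.exp ?_) (Real.exp_log hP')).le
      simp only [hℓ]
      ring
    · simpa using hP a
  have hQq : ∀ a, F * q a * Real.exp (-l * ℓ a) ≤ Q a := by
    intro a
    simp only [hqdef]
    split_ifs with h
    · have hP' := (hP a).lt_of_ne' h.1
      have hQ' := (hQ a).lt_of_ne' h.2
      rw [mul_div_cancel₀ _ hpos.ne', Real.rpow_def_of_pos hP', Real.rpow_def_of_pos hQ',
        ← Real.exp_add, ← Real.exp_add]
      refine (Eq.trans (congrArg Real.exp ?_) (Real.exp_log hQ')).le
      simp only [hℓ]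
      ring
    · simpa using hQ a
  have hprod : ∀ (R : α → ℝ) (c : ℝ), (∀ a, F * q a * Real.exp (c * ℓ a) ≤ R a) →
      ∀ (N : ℕ) (y : Fin N → α),
        F ^ N * (∏ i, q (y i)) * Real.exp (c * ∑ i, ℓ (y i)) ≤ ∏ i, R (y i) := by
    intro R c hR N y
    have := Finset.prod_le_prod (s := Finset.univ)
      (fun i _ => mul_nonneg (mul_nonneg hpos.le (hq0 (y i))) (Real.exp_pos _).le)
      (fun i _ => hR (y i))
    simpa [Finset.prod_mul_distrib, ← Real.exp_sum, Finset.mul_sum] using this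
  set v := ∑ a, q a * (ℓ a - m) ^ 2
  have hlim : Tendsto (fun N : ℕ => v / (ε ^ 2 * N)) atTop (𝓝 0) :=
    Tendsto.div_atTop tendsto_const_nhds
      (tendsto_natCast_atTop_atTop.const_mul_atTop (by positivity))
  filter_upwards [hlim.eventually (ge_mem_nhds (by norm_num : (0 : ℝ) < 1 / 2)),
    eventually_gt_atTop 0] with N hN hN0
  have hcheb := one_sub_le_sum_prod_filter q ℓ hq0 hq1 hε hN0
  have hNpos : (0 : ℝ) < N := by exact_mod_cast hN0
  have hexp : 0 ≤ F ^ N * Real.exp (-(ε * N)) := by positivity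
  calc 1 / 2 * (F ^ N * Real.exp (-(ε * N)))
      ≤ (∑ y : Fin N → α with |(∑ i, ℓ (y i)) - N * m| ≤ ε * N, ∏ i, q (y i)) *
          (F ^ N * Real.exp (-(ε * N))) :=
        mul_le_mul_of_nonneg_right (by linarith) hexp
    _ ≤ ∑ y : Fin N → α with |(∑ i, ℓ (y i)) - N * m| ≤ ε * N,
          min (∏ i, P (y i)) (∏ i, Q (y i)) := by
        rw [Finset.sum_mul]
        refine Finset.sum_le_sum fun y hy => ?_
        have hy' := abs_le.1 (Finset.mem_filter.1 hy).2
        have hqy : 0 ≤ F ^ N * ∏ i, q (y i) :=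
          mul_nonneg (by positivity) (Finset.prod_nonneg fun i _ => hq0 _)
        have h1 := mul_nonneg hNpos.le hm1
        have h0 := mul_nonneg hNpos.le (neg_nonneg.2 hm0)
        have hεN : 0 < ε * N := by positivity
        have hl0 := hl.1
        have hl1 : 0 ≤ 1 - l := sub_nonneg.2 hl.2
        refine le_min (le_trans ?_ (hprod P (1 - l) hPq N y))
          (le_trans ?_ (hprod Q (-l) hQq N y))
        · calc _ = F ^ N * (∏ i, q (y i)) * Real.exp (-(ε * N)) := by ring
            _ ≤ _ := by
              refine mul_le_mul_of_nonneg_left (Real.exp_le_exp.2 ?_) hqy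
              -- `(1-l) ∑ ℓ ≥ (1-l)(Nm - εN) ≥ -εN`, since `(1-l)m ≥ 0`; for `Q` the sign `lm ≤ 0`
              -- is used likewise.
              nlinarith [mul_nonneg hl1 (sub_nonneg.2 hy'.1), mul_nonneg hl0 hεN.le]
        · calc _ = F ^ N * (∏ i, q (y i)) * Real.exp (-(ε * N)) := by ring
            _ ≤ _ := by
              refine mul_le_mul_of_nonneg_left (Real.exp_le_exp.2 ?_) hqy
              nlinarith [mul_nonneg hl0 (sub_nonneg.2 hy'.2), mul_nonneg hl1 hεN.le]
    _ ≤ _ := Finset.sum_le_univ_sum_of_nonneg fun y =>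
        le_min (Finset.prod_nonneg fun i _ => hP _) (Finset.prod_nonneg fun i _ => hQ _)

end Tilting

/-! ### Upper bound on the overlap, and the Chernoff sum at the endpoints. -/

section ChernoffBounds

variable {α : Type*} [Fintype α]

lemma min_le_rpow_mul_rpow (a b : ℝ≥0∞) {l : ℝ} (hl : l ∈ Set.Icc (0 : ℝ) 1) :
    min a b ≤ a ^ l * b ^ (1 - l) := by
  have hl1 : 0 ≤ 1 - l := sub_nonneg.2 hl.2
  calc min a b = (min a b) ^ l * (min a b) ^ (1 - l) := by
        rw [← ENNReal.rpow_add_of_nonneg _ _ hl.1 hl1, add_sub_cancel, ENNReal.rpow_one]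
    _ ≤ _ := mul_le_mul' (ENNReal.rpow_le_rpow (min_le_left _ _) hl.1)
        (ENNReal.rpow_le_rpow (min_le_right _ _) hl1)

/-- Chernoff's upper bound for the overlap of two `N`-fold products. -/
lemma sum_min_prod_le (P Q : α → ℝ≥0∞) {l : ℝ} (hl : l ∈ Set.Icc (0 : ℝ) 1) (N : ℕ) :
    ∑ y : Fin N → α, min (∏ i, P (y i)) (∏ i, Q (y i)) ≤
      (∑ a, P a ^ l * Q a ^ (1 - l)) ^ N := by
  rw [Fintype.sum_pow]
  refine Finset.sum_le_sum fun y _ => (min_le_rpow_mul_rpow _ _ hl).trans_eq ?_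
  rw [← ENNReal.prod_rpow_of_nonneg hl.1, ← ENNReal.prod_rpow_of_nonneg (sub_nonneg.2 hl.2),
    Finset.prod_mul_distrib]

lemma sum_rpow_mul_rpow_eq_ofReal_affinity {P Q : α → ℝ} (hP : ∀ a, 0 ≤ P a) (hQ : ∀ a, 0 ≤ Q a)
    {l : ℝ} (hl : l ∈ Set.Ioo (0 : ℝ) 1) :
    ∑ a, ENNReal.ofReal (P a) ^ l * ENNReal.ofReal (Q a) ^ (1 - l) =
      ENNReal.ofReal (affinity P Q l) := by
  have hl1 : 0 < 1 - l := sub_pos.2 hl.2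
  unfold affinity
  rw [ENNReal.ofReal_sum_of_nonneg fun a _ =>
    mul_nonneg (Real.rpow_nonneg (hP a) _) (Real.rpow_nonneg (hQ a) _), Finset.sum_filter]
  refine Finset.sum_congr rfl fun a _ => ?_
  split_ifs with h
  · rw [ENNReal.ofReal_mul (Real.rpow_nonneg (hP a) _),
      ENNReal.ofReal_rpow_of_nonneg (hP a) hl.1.le, ENNReal.ofReal_rpow_of_nonneg (hQ a) hl1.le]
  · rw [not_and_or, not_not, not_not] at h
    rcases h with h | h <;> simp [h, hl.1, hl1]

/-- At `l = 0, 1` the convention `0^0 = 1` lets the full sum exceed the sum over the common support.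
The two agree in the interior, and continuity of `affinity` carries the bound to the endpoints. -/
lemma iInf_log_le_log_affinity {P Q : α → ℝ} (hP : ∀ a, 0 ≤ P a) (hQ : ∀ a, 0 ≤ Q a)
    {l : ℝ} (hl : l ∈ Set.Icc (0 : ℝ) 1) :
    ⨅ r ∈ Set.Icc (0 : ℝ) 1,
        ENNReal.log (∑ a, ENNReal.ofReal (P a) ^ r * ENNReal.ofReal (Q a) ^ (1 - r)) ≤
      ENNReal.log (ENNReal.ofReal (affinity P Q l)) := by
  set J := ⨅ r ∈ Set.Icc (0 : ℝ) 1,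
        ENNReal.log (∑ a, ENNReal.ofReal (P a) ^ r * ENNReal.ofReal (Q a) ^ (1 - r))
  have hcont : Continuous fun r => ENNReal.log (ENNReal.ofReal (affinity P Q r)) :=
    ENNReal.continuous_log.comp (ENNReal.continuous_ofReal.comp
      (continuous_iff_continuousAt.2 fun r => (hasDerivAt_affinity hP hQ r).continuousAt))
  have hclosed : IsClosed {r | J ≤ ENNReal.log (ENNReal.ofReal (affinity P Q r))} :=
    isClosed_le continuous_const hcont
  have hsub : Set.Ioo (0 : ℝ) 1 ⊆ {r | J ≤ ENNReal.log (ENNReal.ofReal (affinity P Q r))} := by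
    intro r hr
    rw [Set.mem_ofPred_eq, ← sum_rpow_mul_rpow_eq_ofReal_affinity hP hQ hr]
    exact iInf₂_le r (Set.Ioo_subset_Icc_self hr)
  have := hclosed.closure_subset_iff.2 hsub
  rw [closure_Ioo zero_ne_one] at this
  exact this hl

lemma one_div_mul_log_ofReal_mul_exp {c : ℝ} (hc : 0 < c) (r : ℝ) {N : ℕ} (hN : 0 < N) :
    (((1 / (N : ℝ) : ℝ)) : EReal) * ENNReal.log (ENNReal.ofReal (c * Real.exp (r * N))) =
      ((Real.log c / N + r : ℝ) : EReal) := by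
  have hN' : (N : ℝ) ≠ 0 := by exact_mod_cast hN.ne'
  rw [ENNReal.log_ofReal_of_pos (by positivity), Real.log_mul hc.ne' (Real.exp_pos _).ne',
    Real.log_exp, ← EReal.coe_mul]
  congr 1
  field_simp

lemma tendsto_log_div_add (c r : ℝ) :
    Tendsto (fun N : ℕ => c / (N : ℝ) + r) atTop (𝓝 r) := by
  simpa using (tendsto_const_div_atTop_nhds_zero_nat c).add_const r

end ChernoffBounds

/-! ### The error exponent of MAP estimation. -/

section ErrorProb

variable {L K : ℕ}

instance [NeZero L] (V : Fin K ↪ ZMod L) (ξ : PMF (ZMod L)) (p : I) (x : Signal L) :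
    IsProbabilityMeasure (obsLaw V ξ p x) := by
  unfold obsLaw noiseLaw noiseBit
  exact Measure.isProbabilityMeasure_map (Measurable.of_discrete).aemeasurable

variable [NeZero L] (V : Fin K ↪ ZMod L) (ξ : PMF (ZMod L)) (p : I) (π : PMF (Signal L))

lemma sampleLaw_singleton (N : ℕ) (x : Signal L) (y : Fin N → Obs K) :
    sampleLaw V ξ p N x {y} = ∏ i, obsLaw V ξ p x {y i} := by
  rw [sampleLaw, Measure.pi_singleton]

lemma errorProb_eq_sum (N : ℕ) (g : (Fin N → Obs K) → Signal L) :
    errorProb V ξ p π N g =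
      ∑ y : Fin N → Obs K, ∑ x with g y ≠ x, sampleLaw V ξ p N x {y} * π x := by
  simp only [errorProb, Finset.sum_filter]
  rw [Finset.sum_comm]
  refine Finset.sum_congr rfl fun x _ => ?_
  rw [← Finset.sum_filter, ← Finset.sum_mul, sum_measure_singleton]
  simp

/-- On each sample the rule misses at least one of the two signals. -/
lemma le_errorProb {x₁ x₂ : Signal L} (hx : x₁ ≠ x₂) (N : ℕ) (g : (Fin N → Obs K) → Signal L) :
    min (π x₁) (π x₂) * ∑ y : Fin N → Obs K,
        min (∏ i, obsLaw V ξ p x₁ {y i}) (∏ i, obsLaw V ξ p x₂ {y i}) ≤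
      errorProb V ξ p π N g := by
  rw [errorProb_eq_sum, Finset.mul_sum]
  refine Finset.sum_le_sum fun y _ => ?_
  simp only [← sampleLaw_singleton]
  have key : ∀ x, g y ≠ x → sampleLaw V ξ p N x {y} * π x ≤
      ∑ x with g y ≠ x, sampleLaw V ξ p N x {y} * π x := fun x h =>
    Finset.single_le_sum (f := fun x => sampleLaw V ξ p N x {y} * π x)
      (fun _ _ => zero_le) (by simpa using h)
  by_cases h : g y = x₁
  · refine le_trans ?_ (key x₂ (h ▸ hx))
    rw [mul_comm]
    exact mul_le_mul' (min_le_right _ _) (min_le_right _ _)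
  · refine le_trans ?_ (key x₁ h)
    rw [mul_comm]
    exact mul_le_mul' (min_le_left _ _) (min_le_left _ _)

-- By maximality, a missed `x` has joint probability at most the likelihoods of both `x` and `g y`;
-- charge it to the pair `(x, g y)`. If either signal has zero prior, the term is zero.
open Classical in
lemma errorProb_le (N : ℕ) (g : (Fin N → Obs K) → Signal L) (hg : IsMAP V ξ p π N g) :
    errorProb V ξ p π N g ≤
      ∑ x : Signal L × Signal L with x.1 ≠ x.2 ∧ x.1 ∈ π.support ∧ x.2 ∈ π.support,
        ∑ y : Fin N → Obs K,
          min (∏ i, obsLaw V ξ p x.1 {y i}) (∏ i, obsLaw V ξ p x.2 {y i}) := by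
  rw [errorProb_eq_sum, Finset.sum_comm]
  refine Finset.sum_le_sum fun y _ => ?_
  simp only [← sampleLaw_singleton]
  set B : Signal L × Signal L → ℝ≥0∞ :=
    fun x => min (sampleLaw V ξ p N x.1 {y}) (sampleLaw V ξ p N x.2 {y})
  calc ∑ x with g y ≠ x, sampleLaw V ξ p N x {y} * π x
      ≤ ∑ x with g y ≠ x, if x ∈ π.support ∧ g y ∈ π.support then B (x, g y) else 0 := by
        refine Finset.sum_le_sum fun x _ => ?_
        have hm := hg y x
        rw [mul_comm]
        split_ifs with h
        · refine le_min (mul_le_of_le_one_left zero_le (π.coe_le_one x)) (hm.trans ?_)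
          exact mul_le_of_le_one_left zero_le (π.coe_le_one _)
        · rw [not_and_or, PMF.mem_support_iff, PMF.mem_support_iff, not_not, not_not] at h
          rcases h with h | h
          · simp [h]
          · simpa [h] using hm
    _ = ∑ x with g y ≠ x ∧ x ∈ π.support ∧ g y ∈ π.support, B (x, g y) := by
        rw [← Finset.sum_filter, Finset.filter_filter]
    _ = ∑ z ∈ (Finset.univ.filter fun x => g y ≠ x ∧ x ∈ π.support ∧ g y ∈ π.support).image
          fun x => (x, g y), B z := by
        rw [Finset.sum_image fun a _ b _ h => (Prod.mk.inj h).1]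
    _ ≤ _ := by
        refine Finset.sum_le_sum_of_subset fun z hz => ?_
        obtain ⟨x, hx, rfl⟩ := Finset.mem_image.1 hz
        have := (Finset.mem_filter.1 hx).2
        exact Finset.mem_filter.2 ⟨Finset.mem_univ _, this.1.symm, this.2⟩

/-- The error exponent of any rule is at most the Chernoff information of any two signals. -/
lemma eventually_lt_log_errorProb (g : ∀ N : ℕ, (Fin N → Obs K) → Signal L)
    {x₁ x₂ : Signal L} (h₁ : x₁ ∈ π.support) (h₂ : x₂ ∈ π.support) (hx : x₁ ≠ x₂) {a : EReal}
    (ha : a < -chernoffInfo (obsLaw V ξ p x₁) (obsLaw V ξ p x₂)) :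
    ∀ᶠ N : ℕ in atTop,
      a < (((1 / (N : ℝ) : ℝ)) : EReal) * ENNReal.log (errorProb V ξ p π N (g N)) := by
  set P : Obs K → ℝ := fun y => (obsLaw V ξ p x₁).real {y} with hPdef
  set Q : Obs K → ℝ := fun y => (obsLaw V ξ p x₂).real {y} with hQdef
  have hP : ∀ y, 0 ≤ P y := fun y => measureReal_nonneg
  have hQ : ∀ y, 0 ≤ Q y := fun y => measureReal_nonneg
  have hPe : ∀ y, obsLaw V ξ p x₁ {y} = ENNReal.ofReal (P y) := fun y =>
    (ofReal_measureReal).symm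
  have hQe : ∀ y, obsLaw V ξ p x₂ {y} = ENNReal.ofReal (Q y) := fun y =>
    (ofReal_measureReal).symm
  rw [chernoffInfo, neg_neg] at ha
  simp only [hPe, hQe] at ha
  obtain ⟨a', haa', ha'⟩ := EReal.lt_iff_exists_real_btwn.1 ha
  -- Disjoint supports would make the infimum `⊥`, leaving no real `a'` below it.
  have hne : ∃ y, P y ≠ 0 ∧ Q y ≠ 0 := by
    by_contra! h
    have hlt := ha'.trans_le (iInf_log_le_log_affinity hP hQ
      (show (1 / 2 : ℝ) ∈ Set.Icc (0 : ℝ) 1 by norm_num))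
    rw [affinity, Finset.filter_false_of_mem fun y _ hy => hy.2 (h y hy.1)] at hlt
    simp at hlt
  obtain ⟨l, hl, hF, hlow⟩ := exists_affinity_lower_bound hP hQ hne
  have hlog := ha'.trans_le (iInf_log_le_log_affinity hP hQ hl)
  rw [ENNReal.log_ofReal_of_pos hF, EReal.coe_lt_coe_iff] at hlog
  set F := affinity P Q l
  set ε := (Real.log F - a') / 2 with hε
  have hε0 : 0 < ε := by rw [hε]; linarith
  have hc0 : min (π x₁) (π x₂) ≠ 0 := by
    rw [PMF.mem_support_iff] at h₁ h₂
    exact (lt_min (pos_iff_ne_zero.2 h₁) (pos_iff_ne_zero.2 h₂)).ne'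
  have hct : min (π x₁) (π x₂) ≠ ⊤ := ne_top_of_le_ne_top (π.apply_ne_top x₁) (min_le_left _ _)
  set c := (min (π x₁) (π x₂)).toReal with hc
  have hcpos : 0 < c := ENNReal.toReal_pos hc0 hct
  filter_upwards [hlow ε hε0, eventually_gt_atTop 0,
    (tendsto_log_div_add (Real.log (c * (1 / 2))) (Real.log F - ε)).eventually
      (lt_mem_nhds (show a' < Real.log F - ε by rw [hε]; linarith))] with N hN hN0 hNa
  have hle : ENNReal.ofReal (c * (1 / 2) * Real.exp ((Real.log F - ε) * N)) ≤
      errorProb V ξ p π N (g N) := by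
    refine le_trans ?_ (le_errorProb V ξ p π hx N (g N))
    have h1 : ∑ y : Fin N → Obs K,
        min (∏ i, obsLaw V ξ p x₁ {y i}) (∏ i, obsLaw V ξ p x₂ {y i}) =
        ENNReal.ofReal (∑ y : Fin N → Obs K, min (∏ i, P (y i)) (∏ i, Q (y i))) := by
      rw [ENNReal.ofReal_sum_of_nonneg fun y _ =>
        le_min (Finset.prod_nonneg fun i _ => hP _) (Finset.prod_nonneg fun i _ => hQ _)]
      refine Finset.sum_congr rfl fun y _ => ?_
      simp only [hPe, hQe]
      rw [← ENNReal.ofReal_prod_of_nonneg fun i _ => hP _,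
        ← ENNReal.ofReal_prod_of_nonneg fun i _ => hQ _, ENNReal.ofReal_min]
    rw [h1, ← ENNReal.ofReal_toReal hct, ← hc, ← ENNReal.ofReal_mul hcpos.le]
    refine ENNReal.ofReal_le_ofReal ?_
    rw [mul_assoc]
    refine mul_le_mul_of_nonneg_left (le_trans (le_of_eq ?_) hN) hcpos.le
    rw [sub_mul, sub_eq_add_neg, Real.exp_add, mul_comm (Real.log F), Real.exp_nat_mul,
      Real.exp_log hF]
  refine haa'.trans (lt_of_lt_of_le ?_ (mul_le_mul_of_nonneg_left (ENNReal.log_le_log hle)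
    (EReal.coe_nonneg.2 (by positivity))))
  rw [one_div_mul_log_ofReal_mul_exp (by positivity) _ hN0]
  exact_mod_cast hNa

/-- The error exponent of a MAP rule is at least the least Chernoff information. -/
lemma eventually_log_errorProb_lt (g : ∀ N : ℕ, (Fin N → Obs K) → Signal L)
    (hg : ∀ N, IsMAP V ξ p π N (g N)) {a m : EReal}
    (hm : ∀ x₁ ∈ π.support, ∀ x₂ ∈ π.support, x₁ ≠ x₂ →
      m ≤ chernoffInfo (obsLaw V ξ p x₁) (obsLaw V ξ p x₂)) (ha : -m < a) :
    ∀ᶠ N : ℕ in atTop,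
      (((1 / (N : ℝ) : ℝ)) : EReal) * ENNReal.log (errorProb V ξ p π N (g N)) < a := by
  classical
  obtain ⟨r, hmr, hra⟩ := EReal.lt_iff_exists_real_btwn.1 ha
  -- The gap between `r` and `r'` absorbs the number of pairs, whose logarithm is divided by `N`.
  obtain ⟨r', hrr', hra'⟩ := EReal.lt_iff_exists_real_btwn.1 hra
  have hrr := EReal.coe_lt_coe_iff.1 hrr'
  set S : Finset (Signal L × Signal L) :=
    Finset.univ.filter fun x => x.1 ≠ x.2 ∧ x.1 ∈ π.support ∧ x.2 ∈ π.support with hS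
  have hpair : ∀ x ∈ S, ∀ N : ℕ, ∑ y : Fin N → Obs K,
      min (∏ i, obsLaw V ξ p x.1 {y i}) (∏ i, obsLaw V ξ p x.2 {y i}) ≤
        ENNReal.ofReal (Real.exp (r * N)) := by
    intro x hx N
    obtain ⟨hne, h₁, h₂⟩ := (Finset.mem_filter.1 hx).2
    have hlt := lt_of_le_of_lt (EReal.neg_le_neg_iff.2 (hm _ h₁ _ h₂ hne)) hmr
    rw [chernoffInfo, neg_neg] at hlt
    simp only [iInf_lt_iff] at hlt
    obtain ⟨l, hl, hlt⟩ := hlt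
    refine (sum_min_prod_le (fun y => obsLaw V ξ p x.1 {y}) (fun y => obsLaw V ξ p x.2 {y})
      hl N).trans ?_
    rw [mul_comm, Real.exp_nat_mul, ENNReal.ofReal_pow (Real.exp_pos _).le]
    refine pow_le_pow_left' ?_ N
    rw [← ENNReal.log_le_log_iff, ENNReal.log_ofReal_of_pos (Real.exp_pos _), Real.log_exp]
    exact hlt.le
  have hbound : ∀ N, errorProb V ξ p π N (g N) ≤
      ENNReal.ofReal (((S.card : ℝ) + 1) * Real.exp (r * N)) := by
    intro N
    refine (errorProb_le V ξ p π N (g N) (hg N)).trans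
      ((Finset.sum_le_card_nsmul S _ _ fun x hx => hpair x hx N).trans ?_)
    rw [nsmul_eq_mul, ← ENNReal.ofReal_natCast, ← ENNReal.ofReal_mul (Nat.cast_nonneg _)]
    refine ENNReal.ofReal_le_ofReal (mul_le_mul_of_nonneg_right (by linarith) (Real.exp_pos _).le)
  filter_upwards [eventually_gt_atTop 0,
    (tendsto_log_div_add (Real.log ((S.card : ℝ) + 1)) r).eventually (gt_mem_nhds hrr)]
    with N hN0 hNr
  refine lt_of_le_of_lt (mul_le_mul_of_nonneg_left (ENNReal.log_le_log (hbound N))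
    (EReal.coe_nonneg.2 (by positivity))) (lt_trans ?_ hra')
  rw [one_div_mul_log_ofReal_mul_exp (by positivity) _ hN0]
  exact_mod_cast hNr

/-- The exponent of the error probability of MAP estimation is the least Chernoff information. -/
theorem tendsto_log_errorProb (hπ : π.support.Nontrivial)
    (g : ∀ N : ℕ, (Fin N → Obs K) → Signal L) (hg : ∀ N, IsMAP V ξ p π N (g N)) :
    ∃ m : EReal,
      IsLeast {c : EReal | ∃ x₁ ∈ π.support, ∃ x₂ ∈ π.support, x₁ ≠ x₂ ∧
        c = chernoffInfo (obsLaw V ξ p x₁) (obsLaw V ξ p x₂)} m ∧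
      Tendsto (fun N : ℕ => (((1 / (N : ℝ) : ℝ)) : EReal) *
        ENNReal.log (errorProb V ξ p π N (g N))) atTop (𝓝 (-m)) := by
  set C := {c : EReal | ∃ x₁ ∈ π.support, ∃ x₂ ∈ π.support, x₁ ≠ x₂ ∧
        c = chernoffInfo (obsLaw V ξ p x₁) (obsLaw V ξ p x₂)} with hC
  have hfin : C.Finite := by
    refine (Set.finite_range fun x : Signal L × Signal L =>
      chernoffInfo (obsLaw V ξ p x.1) (obsLaw V ξ p x.2)).subset ?_
    rintro c ⟨x₁, -, x₂, -, -, rfl⟩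
    exact ⟨(x₁, x₂), rfl⟩
  have hne : C.Nonempty := by
    obtain ⟨x₁, h₁, x₂, h₂, hx⟩ := hπ
    exact ⟨_, x₁, h₁, x₂, h₂, hx, rfl⟩
  obtain ⟨m, hmC, hm⟩ := Set.exists_min_image C id hfin hne
  refine ⟨m, ⟨hmC, hm⟩, tendsto_order.2 ⟨fun a ha => ?_, fun a ha => ?_⟩⟩
  · obtain ⟨x₁, h₁, x₂, h₂, hx, rfl⟩ := hmC
    exact eventually_lt_log_errorProb V ξ p π g h₁ h₂ hx ha
  · exact eventually_log_errorProb_lt V ξ p π g hg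
      (fun x₁ h₁ x₂ h₂ hx => hm _ ⟨x₁, h₁, x₂, h₂, hx, rfl⟩) ha

end ErrorProb

/-! ### Taylor estimates. -/

section Taylor

lemma abs_le_mul_pow_succ_of_hasDerivAt {f f' : ℝ → ℝ} {M R : ℝ} {n : ℕ} (hM : 0 ≤ M)
    (hf : ∀ z, |z| ≤ R → HasDerivAt f (f' z) z) (hf' : ∀ z, |z| ≤ R → |f' z| ≤ M * |z| ^ n)
    (h0 : f 0 = 0) {z : ℝ} (hz : |z| ≤ R) : |f z| ≤ M * |z| ^ (n + 1) := by
  have hmem : ∀ w ∈ Set.Icc (-|z|) |z|, |w| ≤ |z| := fun w hw => abs_le.2 hw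
  have h := (convex_Icc (-|z|) |z|).norm_image_sub_le_of_norm_hasDerivWithin_le
    (f := f) (f' := f') (C := M * |z| ^ n) (x := 0) (y := z)
    (fun w hw => (hf w ((hmem w hw).trans hz)).hasDerivWithinAt)
    (fun w hw => (hf' w ((hmem w hw).trans hz)).trans
      (mul_le_mul_of_nonneg_left (pow_le_pow_left₀ (abs_nonneg _) (hmem w hw) n) hM))
    ⟨neg_nonpos.2 (abs_nonneg z), abs_nonneg z⟩ (abs_le.1 le_rfl)
  rw [h0, sub_zero, sub_zero, Real.norm_eq_abs, Real.norm_eq_abs] at h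
  rwa [pow_succ, ← mul_assoc]

lemma hasDerivAt_one_add_rpow (α : ℝ) {z : ℝ} (hz : |z| ≤ 1 / 2) :
    HasDerivAt (fun z : ℝ => (1 + z) ^ α) (α * (1 + z) ^ (α - 1)) z := by
  have hz' := (abs_le.1 hz).1
  have := ((hasDerivAt_id z).const_add 1).rpow_const (p := α) (Or.inl (by simp; linarith))
  refine this.congr_deriv ?_
  simp

/-- Third-order Taylor expansion of `(1 + z)^l`, uniformly in `0 ≤ l ≤ 1`. -/
lemma abs_one_add_rpow_sub_taylor_le {l : ℝ} (hl : l ∈ Set.Icc (0 : ℝ) 1) {z : ℝ}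
    (hz : |z| ≤ 1 / 2) :
    |(1 + z) ^ l - (1 + l * z - l * (1 - l) / 2 * z ^ 2 + l * (1 - l) * (2 - l) / 6 * z ^ 3)| ≤
      96 * |z| ^ 4 := by
  obtain ⟨hl0, hl1⟩ := hl
  -- Integrating four times from `(1+z)^(l-4) ≤ 2^4` collects the factors `|l-3| ≤ 3`, `|l-2| ≤ 2`,
  -- `|l-1| ≤ 1`, `|l| ≤ 1`: `96 = 16 · 3 · 2`.
  have step : ∀ {f f' : ℝ → ℝ} {M c : ℝ} {n : ℕ}, 0 ≤ M → 0 ≤ c →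
      (∀ z, |z| ≤ 1 / 2 → ∃ k, |k| ≤ c ∧ HasDerivAt f (k * f' z) z) →
      (∀ z, |z| ≤ 1 / 2 → |f' z| ≤ M * |z| ^ n) → f 0 = 0 →
      ∀ z, |z| ≤ 1 / 2 → |f z| ≤ c * M * |z| ^ (n + 1) := by
    intro f f' M c n hM hc hf hf' h0 z hz
    choose! k hk hkf using hf
    refine abs_le_mul_pow_succ_of_hasDerivAt (f' := fun z => k z * f' z) (mul_nonneg hc hM) hkf
      (fun z hz => ?_) h0 hz
    rw [abs_mul, mul_assoc]
    exact mul_le_mul (hk z hz) (hf' z hz) (abs_nonneg _) hc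
  have h0 : ∀ z : ℝ, |z| ≤ 1 / 2 → |(1 + z) ^ (l - 4)| ≤ 16 * |z| ^ 0 := by
    intro z hz
    have hz' := (abs_le.1 hz).1
    have hpos : (0 : ℝ) < 1 + z := by linarith
    rw [abs_of_pos (Real.rpow_pos_of_pos hpos _), pow_zero, mul_one]
    calc (1 + z) ^ (l - 4) ≤ (1 / 2 : ℝ) ^ (l - 4) :=
          Real.rpow_le_rpow_of_nonpos (by norm_num) (by linarith) (by linarith)
      _ ≤ (1 / 2 : ℝ) ^ (-4 : ℝ) :=
          Real.rpow_le_rpow_of_exponent_ge (by norm_num) (by norm_num) (by linarith)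
      _ = 16 := by
          rw [show (-4 : ℝ) = ((-4 : ℤ) : ℝ) by norm_num, Real.rpow_intCast]
          norm_num
  have h1 := step (f := fun z => (1 + z) ^ (l - 3) - 1) (c := 3) (by norm_num) (by norm_num)
    (fun z hz => ⟨l - 3, abs_le.2 ⟨by linarith, by linarith⟩,
      ((hasDerivAt_one_add_rpow (l - 3) hz).sub_const 1).congr_deriv (by ring_nf)⟩) h0 (by simp)
  have h2 := step (f := fun z => (1 + z) ^ (l - 2) - 1 - (l - 2) * z) (c := 2) (by norm_num)
    (by norm_num)
    (fun z hz => ⟨l - 2, abs_le.2 ⟨by linarith, by linarith⟩,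
      (((hasDerivAt_one_add_rpow (l - 2) hz).sub_const 1).sub
        ((hasDerivAt_id z).const_mul (l - 2))).congr_deriv (by ring_nf)⟩) h1 (by simp)
  have h3 := step (f := fun z => (1 + z) ^ (l - 1) - 1 - (l - 1) * z -
      (l - 1) * (l - 2) / 2 * z ^ 2) (c := 1) (by norm_num) (by norm_num)
    (fun z hz => ⟨l - 1, abs_le.2 ⟨by linarith, by linarith⟩,
      ((((hasDerivAt_one_add_rpow (l - 1) hz).sub_const 1).sub
        ((hasDerivAt_id z).const_mul (l - 1))).sub
        ((hasDerivAt_pow 2 z).const_mul ((l - 1) * (l - 2) / 2))).congr_deriv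
          (by simp; ring_nf)⟩) h2 (by simp)
  have h4 := step (f := fun z => (1 + z) ^ l - (1 + l * z - l * (1 - l) / 2 * z ^ 2 +
      l * (1 - l) * (2 - l) / 6 * z ^ 3)) (c := 1) (by norm_num) (by norm_num)
    (fun z hz => ⟨l, abs_le.2 ⟨by linarith, by linarith⟩,
      ((hasDerivAt_one_add_rpow l hz).sub
        (((((hasDerivAt_id z).const_mul l).const_add 1).sub
          ((hasDerivAt_pow 2 z).const_mul (l * (1 - l) / 2))).add
          ((hasDerivAt_pow 3 z).const_mul (l * (1 - l) * (2 - l) / 6)))).congr_deriv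
          (by simp; ring_nf)⟩) h3 (by simp)
  have := h4 z hz
  norm_num at this ⊢
  exact this

lemma isBigO_pow_of_le {m n : ℕ} (h : n ≤ m) :
    (fun z : ℝ => z ^ m) =O[𝓝 0] fun z => z ^ n := by
  refine IsBigO.of_bound 1 ?_
  filter_upwards [Metric.ball_mem_nhds (0 : ℝ) one_pos] with z hz
  rw [one_mul, norm_pow, norm_pow]
  exact pow_le_pow_of_le_one (norm_nonneg _) (mem_ball_zero_iff.1 hz).le h

lemma isBigO_sub_of_even {f : ℝ → ℝ} (hf : AnalyticAt ℝ f 0) (he : ∀ z, f (-z) = f z) :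
    (fun z => f z - f 0) =O[𝓝 0] fun z => z ^ 2 := by
  have hd : deriv f 0 = 0 := by
    have h := deriv_comp_neg f 0
    simp only [he, neg_zero] at h
    linarith
  obtain ⟨p, hp⟩ := hf
  have h := hp.isBigO_sub_partialSum_pow 2
  have h1 : p.coeff 1 = 0 := by
    rw [← hd, hp.deriv]
    simp
  have h0 : p.coeff 0 = f 0 := hp.coeff_zero _
  simp only [FormalMultilinearSeries.partialSum, Finset.sum_range_succ, Finset.sum_range_zero,
    FormalMultilinearSeries.apply_eq_pow_smul_coeff, h0, h1, zero_add] at h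
  simpa using h

/-- `log x` lies between `1 - 1/x` and `x - 1`, whose gap is `(x-1)²/x`. -/
lemma abs_log_sub_sub_one_le {x : ℝ} (hx : |x - 1| ≤ 1 / 2) :
    |Real.log x - (x - 1)| ≤ 2 * (x - 1) ^ 2 := by
  have hx' := abs_le.1 hx
  have hpos : 0 < x := by linarith
  have h1 := Real.log_le_sub_one_of_pos hpos
  have h2 := Real.one_sub_inv_le_log_of_pos hpos
  have h3 : (x - 1) - (1 - x⁻¹) = (x - 1) ^ 2 * x⁻¹ := by
    field_simp
  have h4 : x⁻¹ ≤ 2 := by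
    rw [inv_le_comm₀ hpos two_pos]
    linarith
  have h5 := mul_le_mul_of_nonneg_left h4 (sq_nonneg (x - 1))
  rw [abs_le]
  constructor <;> linarith [sq_nonneg (x - 1)]

end Taylor

/-! ### Chernoff information of nearby laws. -/

section Perturbation

variable {Ω : Type*} [Fintype Ω] {t : ℕ} {b d : Ω → ℝ → ℝ} {τ : Ω ≃ Ω}

/-- Expansion of the Chernoff sums of the family `b + θ^t d` against `b`, when both are uniform to
leading order and change by a permutation of the alphabet under `θ ↦ -θ`. -/
lemma exists_abs_sum_rpow_sub_le (ht : 1 ≤ t) (hb : ∀ y, AnalyticAt ℝ (b y) 0)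
    (hd : ∀ y, AnalyticAt ℝ (d y) 0) (hb0 : ∀ y, 0 < b y 0)
    (hbτ : ∀ y θ, b y (-θ) = b (τ y) θ) (hdτ : ∀ y θ, d y (-θ) = (-1) ^ t * d (τ y) θ)
    (hbs : ∀ θ, ∑ y, b y θ = 1) (hds : ∀ θ, ∑ y, d y θ = 0) :
    ∃ M, ∀ᶠ θ in 𝓝 (0 : ℝ), (∀ y, 0 < b y θ ∧ 0 < b y θ + θ ^ t * d y θ) ∧
      ∀ l ∈ Set.Icc (0 : ℝ) 1,
        |∑ y, (b y θ + θ ^ t * d y θ) ^ l * b y θ ^ (1 - l) -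
          (1 - l * (1 - l) / 2 * (θ ^ (2 * t) * ∑ y, d y 0 ^ 2 / b y 0))| ≤ M * θ ^ (2 * t + 2) := by
  -- With `z = θ^t d/b`, the `j`-th moment `∑ b z^j` is `θ^(jt) Ej`; the first vanishes since `∑ d =
  -- 0`.
  set E2 : ℝ → ℝ := fun θ => ∑ y, d y θ ^ 2 / b y θ with hE2
  set E3 : ℝ → ℝ := fun θ => ∑ y, d y θ ^ 3 / b y θ ^ 2 with hE3
  set E4 : ℝ → ℝ := fun θ => ∑ y, d y θ ^ 4 / b y θ ^ 3 with hE4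
  have hA2 : AnalyticAt ℝ E2 0 := Finset.analyticAt_fun_sum _ fun y _ =>
    ((hd y).pow 2).div (hb y) (hb0 y).ne'
  have hA3 : AnalyticAt ℝ E3 0 := Finset.analyticAt_fun_sum _ fun y _ =>
    ((hd y).pow 3).div ((hb y).pow 2) (pow_pos (hb0 y) 2).ne'
  have hA4 : AnalyticAt ℝ E4 0 := Finset.analyticAt_fun_sum _ fun y _ =>
    ((hd y).pow 4).div ((hb y).pow 3) (pow_pos (hb0 y) 3).ne'
  have hsgn : ((-1 : ℝ) ^ t) ^ 2 = 1 := by rw [← pow_mul, mul_comm, pow_mul]; norm_num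
  have he2 : ∀ θ, E2 (-θ) = E2 θ := by
    intro θ
    simp only [hE2, hbτ, hdτ, mul_pow, hsgn, one_mul]
    exact τ.sum_comp fun y => d y θ ^ 2 / b y θ
  have he3 : ∀ θ, E3 (-θ) = (-1) ^ t * E3 θ := by
    intro θ
    have h3 : ((-1 : ℝ) ^ t) ^ 3 = (-1) ^ t := by rw [pow_succ, hsgn, one_mul]
    simp only [hE3, hbτ, hdτ, mul_pow, h3, Finset.mul_sum, mul_div_assoc]
    exact τ.sum_comp fun y => (-1) ^ t * (d y θ ^ 3 / b y θ ^ 2)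
  obtain ⟨M2, hM2⟩ := (isBigO_sub_of_even hA2 he2).bound
  -- Even `t` is at least 2, so `3t ≥ 2t+2`. For odd `t`, `E3` is odd and supplies one more power of
  -- `θ`, which is needed when `t = 1`.
  have hO3 : (fun θ : ℝ => θ ^ (3 * t) * E3 θ) =O[𝓝 0] fun θ => θ ^ (2 * t + 2) := by
    rcases Nat.even_or_odd t with hte | hto
    · have ht2 : 2 * t + 2 ≤ 3 * t + 0 := by
        obtain ⟨k, hk⟩ := hte
        omega
      have h1 : (fun θ : ℝ => θ ^ (3 * t)) =O[𝓝 0] fun θ => θ ^ (2 * t + 2) := isBigO_pow_of_le (by omega)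
      simpa using h1.mul (hA3.continuousAt.norm.isBoundedUnder_le.isBigO_one ℝ)
    · have h0 : E3 0 = 0 := by
        have := he3 0
        rw [hto.neg_one_pow, neg_zero] at this
        linarith
      have h2 : E3 =O[𝓝 0] fun θ : ℝ => θ := by
        simpa [h0] using hA3.differentiableAt.hasDerivAt.isBigO_sub
      have h1 : (fun θ : ℝ => θ ^ (3 * t + 1)) =O[𝓝 0] fun θ => θ ^ (2 * t + 2) := isBigO_pow_of_le (by omega)
      refine ((isBigO_refl (fun θ : ℝ => θ ^ (3 * t)) (𝓝 0)).mul h2).trans ?_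
      simpa [pow_succ] using h1
  obtain ⟨M3, hM3⟩ := hO3.bound
  refine ⟨|M2| + |M3| + 96 * (E4 0 + 1), ?_⟩
  have hE40 : 0 ≤ E4 0 := Finset.sum_nonneg fun y _ =>
    div_nonneg (by positivity) (pow_pos (hb0 y) 3).le
  have hbpos : ∀ᶠ θ in 𝓝 (0 : ℝ), ∀ y, 0 < b y θ :=
    eventually_all.2 fun y => (hb y).continuousAt.eventually (lt_mem_nhds (hb0 y))
  have hz : ∀ᶠ θ in 𝓝 (0 : ℝ), ∀ y, |θ ^ t * (d y θ / b y θ)| < 1 / 2 := by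
    refine eventually_all.2 fun y => ?_
    have hc : ContinuousAt (fun θ : ℝ => |θ ^ t * (d y θ / b y θ)|) 0 :=
      ((continuousAt_id.pow t).mul ((hd y).continuousAt.div (hb y).continuousAt
        (hb0 y).ne')).abs
    refine hc.eventually (gt_mem_nhds ?_)
    simp [zero_pow (by omega : t ≠ 0)]
  filter_upwards [hM2, hM3, hbpos, hz, hA4.continuousAt.eventually
    (gt_mem_nhds (lt_add_one (E4 0))), Metric.ball_mem_nhds (0 : ℝ) one_pos]
    with θ h2 h3 hbp hz h4 hθ1
  have hθ : |θ| ≤ 1 := by simpa using (mem_ball_zero_iff.1 hθ1).le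
  have hfac : ∀ y, b y θ + θ ^ t * d y θ = b y θ * (1 + θ ^ t * (d y θ / b y θ)) := by
    intro y
    have := (hbp y).ne'
    field_simp
  have hpos : ∀ y, 0 < 1 + θ ^ t * (d y θ / b y θ) := fun y => by
    linarith [(abs_lt.1 (hz y)).1]
  refine ⟨fun y => ⟨hbp y, hfac y ▸ mul_pos (hbp y) (hpos y)⟩, fun l hl => ?_⟩
  set R : Ω → ℝ := fun y => (1 + θ ^ t * (d y θ / b y θ)) ^ l -
    (1 + l * (θ ^ t * (d y θ / b y θ)) - l * (1 - l) / 2 * (θ ^ t * (d y θ / b y θ)) ^ 2 +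
      l * (1 - l) * (2 - l) / 6 * (θ ^ t * (d y θ / b y θ)) ^ 3) with hR
  have hterm : ∀ y, (b y θ + θ ^ t * d y θ) ^ l * b y θ ^ (1 - l) =
      b y θ + l * θ ^ t * d y θ - l * (1 - l) / 2 * θ ^ (2 * t) * (d y θ ^ 2 / b y θ) +
        l * (1 - l) * (2 - l) / 6 * θ ^ (3 * t) * (d y θ ^ 3 / b y θ ^ 2) + b y θ * R y := by
    intro y
    have hby := hbp y
    rw [hfac, Real.mul_rpow hby.le (hpos y).le, mul_right_comm, ← Real.rpow_add hby,
      add_sub_cancel, Real.rpow_one, hR]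
    field_simp
    ring
  have hRb : |∑ y, b y θ * R y| ≤ 96 * (E4 0 + 1) * θ ^ (2 * t + 2) := by
    calc |∑ y, b y θ * R y| ≤ ∑ y, |b y θ * R y| := Finset.abs_sum_le_sum_abs _ _
      _ ≤ ∑ y, 96 * θ ^ (4 * t) * (d y θ ^ 4 / b y θ ^ 3) := by
          refine Finset.sum_le_sum fun y _ => ?_
          have hby := hbp y
          rw [abs_mul, abs_of_pos hby]
          refine (mul_le_mul_of_nonneg_left
            (abs_one_add_rpow_sub_taylor_le hl (hz y).le) hby.le).trans_eq ?_
          rw [Even.pow_abs ⟨2, rfl⟩, mul_pow, div_pow, ← pow_mul, mul_comm t 4]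
          field_simp
          ring
      _ = 96 * θ ^ (4 * t) * E4 θ := by rw [← Finset.mul_sum]
      _ ≤ 96 * θ ^ (4 * t) * (E4 0 + 1) := by
          refine mul_le_mul_of_nonneg_left h4.le ?_
          have : 0 ≤ θ ^ (4 * t) := (Even.mul_right ⟨2, rfl⟩ t).pow_nonneg θ
          positivity
      _ ≤ 96 * (E4 0 + 1) * θ ^ (2 * t + 2) := by
          have : θ ^ (4 * t) ≤ θ ^ (2 * t + 2) := by
            rw [← (show Even (4 * t) from Even.mul_right ⟨2, rfl⟩ t).pow_abs,
              ← (show Even (2 * t + 2) from ⟨t + 1, by ring⟩).pow_abs]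
            exact pow_le_pow_of_le_one (abs_nonneg _) hθ (by omega)
          nlinarith
  have hθn : 0 ≤ θ ^ (2 * t + 2) := (show Even (2 * t + 2) from ⟨t + 1, by ring⟩).pow_nonneg θ
  have hll : 0 ≤ l * (1 - l) := mul_nonneg hl.1 (sub_nonneg.2 hl.2)
  have hll1 : l * (1 - l) ≤ 1 := by nlinarith [hl.1, hl.2]
  have hb2 : |l * (1 - l) / 2 * θ ^ (2 * t) * (E2 θ - E2 0)| ≤ |M2| * θ ^ (2 * t + 2) := by
    have hθt : 0 ≤ θ ^ (2 * t) := (even_two_mul t).pow_nonneg θ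
    rw [abs_mul, abs_of_nonneg (by positivity)]
    rw [Real.norm_eq_abs, Real.norm_eq_abs, abs_of_nonneg (sq_nonneg θ)] at h2
    have h2' : |E2 θ - E2 0| ≤ |M2| * θ ^ 2 :=
      h2.trans (mul_le_mul_of_nonneg_right (le_abs_self _) (sq_nonneg _))
    calc _ ≤ 1 * θ ^ (2 * t) * (|M2| * θ ^ 2) := by
          refine mul_le_mul (mul_le_mul_of_nonneg_right (by linarith) hθt) h2' (abs_nonneg _) ?_
          positivity
      _ = _ := by ring
  have hb3 : |l * (1 - l) * (2 - l) / 6 * (θ ^ (3 * t) * E3 θ)| ≤ |M3| * θ ^ (2 * t + 2) := by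
    rw [Real.norm_eq_abs, Real.norm_eq_abs, abs_of_nonneg hθn] at h3
    rw [abs_mul, abs_of_nonneg (div_nonneg (mul_nonneg hll (by linarith [hl.2])) (by norm_num))]
    calc _ ≤ 1 * (|M3| * θ ^ (2 * t + 2)) := by
          refine mul_le_mul (by nlinarith [hl.1, hl.2])
            (h3.trans (mul_le_mul_of_nonneg_right (le_abs_self _) hθn)) (abs_nonneg _) zero_le_one
      _ = _ := one_mul _
  have hsum : ∑ y, (b y θ + θ ^ t * d y θ) ^ l * b y θ ^ (1 - l) -
      (1 - l * (1 - l) / 2 * (θ ^ (2 * t) * E2 0)) =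
      -(l * (1 - l) / 2 * θ ^ (2 * t) * (E2 θ - E2 0)) +
        l * (1 - l) * (2 - l) / 6 * (θ ^ (3 * t) * E3 θ) + ∑ y, b y θ * R y := by
    simp only [hterm, Finset.sum_add_distrib, Finset.sum_sub_distrib, ← Finset.mul_sum, hbs, hds]
    ring
  change |_ - (1 - l * (1 - l) / 2 * (θ ^ (2 * t) * E2 0))| ≤ _
  rw [hsum]
  refine (abs_add_three _ _ _).trans ?_
  rw [abs_neg]
  linarith

/-- Linearizing the logarithm costs `O(θ^(4t))`, within the error as `4t ≥ 2t+2`. Since all errors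
are uniform in `l`, the infimum follows from `l(1-l)/2 ≤ 1/8`, with equality at `l = 1/2`. -/
lemma exists_iInf_log_eq (ht : 1 ≤ t) (hb : ∀ y, AnalyticAt ℝ (b y) 0)
    (hd : ∀ y, AnalyticAt ℝ (d y) 0) (hb0 : ∀ y, 0 < b y 0)
    (hbτ : ∀ y θ, b y (-θ) = b (τ y) θ) (hdτ : ∀ y θ, d y (-θ) = (-1) ^ t * d (τ y) θ)
    (hbs : ∀ θ, ∑ y, b y θ = 1) (hds : ∀ θ, ∑ y, d y θ = 0) :
    ∃ M, ∀ᶠ θ in 𝓝 (0 : ℝ), ∃ r : ℝ, |r| ≤ M * θ ^ (2 * t + 2) ∧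
      -⨅ l ∈ Set.Icc (0 : ℝ) 1, ENNReal.log (∑ y, ENNReal.ofReal (b y θ + θ ^ t * d y θ) ^ l *
        ENNReal.ofReal (b y θ) ^ (1 - l)) =
      (((∑ y, d y 0 ^ 2 / b y 0) / 8 * θ ^ (2 * t) + r : ℝ) : EReal) := by
  obtain ⟨M, hM⟩ := exists_abs_sum_rpow_sub_le ht hb hd hb0 hbτ hdτ hbs hds
  set E := ∑ y, d y 0 ^ 2 / b y 0 with hE
  have hE0 : 0 ≤ E := Finset.sum_nonneg fun y _ => div_nonneg (sq_nonneg _) (hb0 y).le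
  have hsmall : ∀ᶠ θ in 𝓝 (0 : ℝ), (E + |M|) * θ ^ (2 * t) < 1 / 2 := by
    have hc : ContinuousAt (fun θ : ℝ => (E + |M|) * θ ^ (2 * t)) 0 := by fun_prop
    refine hc.eventually (gt_mem_nhds ?_)
    simp [zero_pow (by omega : 2 * t ≠ 0)]
  refine ⟨|M| + 2 * (E + |M|) ^ 2, ?_⟩
  filter_upwards [hM, hsmall, Metric.ball_mem_nhds (0 : ℝ) one_pos] with θ ⟨hpos, hH⟩ hs hθ1
  have hθ : |θ| ≤ 1 := by simpa using (mem_ball_zero_iff.1 hθ1).le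
  set H : ℝ → ℝ := fun l => ∑ y, (b y θ + θ ^ t * d y θ) ^ l * b y θ ^ (1 - l) with hHdef
  have hθ0 : 0 ≤ θ ^ (2 * t) := (even_two_mul t).pow_nonneg θ
  have hθn : 0 ≤ θ ^ (2 * t + 2) := (show Even (2 * t + 2) from ⟨t + 1, by ring⟩).pow_nonneg θ
  have hpow : ∀ {m n : ℕ}, Even m → Even n → n ≤ m → θ ^ m ≤ θ ^ n := by
    intro m n hm hn hmn
    rw [← hm.pow_abs, ← hn.pow_abs]
    exact pow_le_pow_of_le_one (abs_nonneg _) hθ hmn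
  have hlog : ∀ l ∈ Set.Icc (0 : ℝ) 1, 0 < H l ∧
      |Real.log (H l) + l * (1 - l) / 2 * (θ ^ (2 * t) * E)| ≤
        (|M| + 2 * (E + |M|) ^ 2) * θ ^ (2 * t + 2) := by
    intro l hl
    have hll : 0 ≤ l * (1 - l) := mul_nonneg hl.1 (sub_nonneg.2 hl.2)
    have hll1 : l * (1 - l) ≤ 1 := by nlinarith [hl.1, hl.2]
    have h1 : |H l - (1 - l * (1 - l) / 2 * (θ ^ (2 * t) * E))| ≤ |M| * θ ^ (2 * t + 2) :=
      (hH l hl).trans (mul_le_mul_of_nonneg_right (le_abs_self M) hθn)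
    have h2 : |H l - 1| ≤ (E + |M|) * θ ^ (2 * t) := by
      have h3 : |M| * θ ^ (2 * t + 2) ≤ |M| * θ ^ (2 * t) :=
        mul_le_mul_of_nonneg_left (hpow ⟨t + 1, by ring⟩ (even_two_mul t) (by omega))
          (abs_nonneg _)
      have h4 : 0 ≤ θ ^ (2 * t) * E := mul_nonneg hθ0 hE0
      have h5 : l * (1 - l) / 2 * (θ ^ (2 * t) * E) ≤ 1 * (θ ^ (2 * t) * E) :=
        mul_le_mul_of_nonneg_right (by linarith) h4
      have h6 : 0 ≤ l * (1 - l) / 2 * (θ ^ (2 * t) * E) := by positivity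
      have h7 := abs_le.1 h1
      rw [abs_le]
      constructor <;> linarith
    have h3 := abs_log_sub_sub_one_le (h2.trans hs.le)
    have h4 : (H l - 1) ^ 2 ≤ (E + |M|) ^ 2 * θ ^ (2 * t + 2) := by
      calc (H l - 1) ^ 2 = |H l - 1| ^ 2 := (sq_abs _).symm
        _ ≤ ((E + |M|) * θ ^ (2 * t)) ^ 2 := pow_le_pow_left₀ (abs_nonneg _) h2 2
        _ = (E + |M|) ^ 2 * θ ^ (4 * t) := by ring
        _ ≤ _ := mul_le_mul_of_nonneg_left
          (hpow (Even.mul_right ⟨2, rfl⟩ t) ⟨t + 1, by ring⟩ (by omega)) (sq_nonneg _)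
    refine ⟨by linarith [(abs_le.1 h2).1], ?_⟩
    have h7 := abs_le.1 h1
    have h8 := abs_le.1 h3
    rw [abs_le]
    constructor <;> linarith
  have hEN : ∀ l ∈ Set.Icc (0 : ℝ) 1, ENNReal.log (∑ y,
      ENNReal.ofReal (b y θ + θ ^ t * d y θ) ^ l * ENNReal.ofReal (b y θ) ^ (1 - l)) =
      (Real.log (H l) : EReal) := by
    intro l hl
    rw [← ENNReal.log_ofReal_of_pos (hlog l hl).1, hHdef, ENNReal.ofReal_sum_of_nonneg fun y _ =>
      mul_nonneg (Real.rpow_nonneg (hpos y).2.le _) (Real.rpow_nonneg (hpos y).1.le _)]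
    congr 1
    refine Finset.sum_congr rfl fun y _ => ?_
    rw [ENNReal.ofReal_mul (Real.rpow_nonneg (hpos y).2.le _),
      ENNReal.ofReal_rpow_of_pos (hpos y).2, ENNReal.ofReal_rpow_of_pos (hpos y).1]
  set B := (|M| + 2 * (E + |M|) ^ 2) * θ ^ (2 * t + 2) with hB
  rw [biInf_congr hEN]
  set J := ⨅ l ∈ Set.Icc (0 : ℝ) 1, (Real.log (H l) : EReal) with hJ
  have hup : J ≤ ((-(E / 8 * θ ^ (2 * t)) + B : ℝ) : EReal) := by
    have hmem : (1 / 2 : ℝ) ∈ Set.Icc (0 : ℝ) 1 := by norm_num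
    refine (iInf₂_le (1 / 2 : ℝ) hmem).trans (EReal.coe_le_coe_iff.2 ?_)
    have := (abs_le.1 (hlog _ hmem).2).2
    linarith
  have hlow : ((-(E / 8 * θ ^ (2 * t)) - B : ℝ) : EReal) ≤ J := by
    refine le_iInf₂ fun l hl => EReal.coe_le_coe_iff.2 ?_
    have h1 := (abs_le.1 (hlog l hl).2).1
    have h2 : l * (1 - l) / 2 * (θ ^ (2 * t) * E) ≤ 1 / 8 * (θ ^ (2 * t) * E) :=
      mul_le_mul_of_nonneg_right (by nlinarith [sq_nonneg (l - 1 / 2)]) (mul_nonneg hθ0 hE0)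
    linarith
  have hJr : J = (J.toReal : EReal) :=
    (EReal.coe_toReal (ne_top_of_le_ne_top (EReal.coe_ne_top _) hup)
      (ne_bot_of_le_ne_bot (EReal.coe_ne_bot _) hlow)).symm
  rw [hJr, EReal.coe_le_coe_iff] at hup hlow
  refine ⟨-J.toReal - E / 8 * θ ^ (2 * t), abs_le.2 ⟨by linarith, by linarith⟩, ?_⟩
  rw [hJr, ← EReal.coe_neg, add_sub_cancel, EReal.toReal_coe]

end Perturbation

/-! ### Walsh characters of the Boolean cube. -/

section Characters

/-- The sign `(-1)^b` of a bit. -/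
noncomputable def bitSign (b : ZMod 2) : ℝ := 1 - 2 * b.val

lemma bitSign_add (a b : ZMod 2) : bitSign (a + b) = bitSign a * bitSign b := by
  have h0 : (0 : ZMod 2).val = 0 := rfl
  have h1 : (1 : ZMod 2).val = 1 := rfl
  have h2 : (1 : ZMod 2) + 1 = 0 := rfl
  have hc : ∀ c : ZMod 2, c = 0 ∨ c = 1 := by decide
  rcases hc a with rfl | rfl <;> rcases hc b with rfl | rfl <;>
    simp only [add_zero, zero_add, bitSign, h0, h1, h2] <;> norm_num

@[simp] lemma bitSign_zero : bitSign 0 = 1 := by simp [bitSign]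

@[simp] lemma bitSign_one : bitSign 1 = -1 := by
  have h1 : (1 : ZMod 2).val = 1 := rfl
  norm_num [bitSign, h1]

lemma bitSign_mul_self (b : ZMod 2) : bitSign b * bitSign b = 1 := by
  rw [← bitSign_add, CharTwo.add_self_eq_zero, bitSign_zero]

lemma sum_bitSign : ∑ b : ZMod 2, bitSign b = 0 := by
  have : (Finset.univ : Finset (ZMod 2)) = {0, 1} := rfl
  rw [this, Finset.sum_pair zero_ne_one]
  simp

variable {K : ℕ}

/-- The Walsh character of the Boolean cube indexed by `A`. -/
noncomputable def walsh (A : Finset (Fin K)) (y : Obs K) : ℝ := ∏ j ∈ A, bitSign (y j)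

lemma walsh_add (A : Finset (Fin K)) (y z : Obs K) : walsh A (y + z) = walsh A y * walsh A z := by
  simp [walsh, bitSign_add, Finset.prod_mul_distrib]

lemma walsh_add_one (A : Finset (Fin K)) (y : Obs K) :
    walsh A (y + 1) = (-1) ^ A.card * walsh A y := by
  rw [walsh_add, mul_comm]
  simp [walsh]

/-- The sum factors over coordinates, and a coordinate in exactly one of the two sets contributes
zero. -/
lemma sum_walsh_mul_walsh (A B : Finset (Fin K)) :
    ∑ y : Obs K, walsh A y * walsh B y = if A = B then 2 ^ K else 0 := by
  have h : ∀ y : Obs K, walsh A y * walsh B y = ∏ j,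
      ((if j ∈ A then bitSign (y j) else 1) * if j ∈ B then bitSign (y j) else 1) := by
    intro y
    rw [Finset.prod_mul_distrib, Finset.prod_ite_mem, Finset.prod_ite_mem, Finset.univ_inter,
      Finset.univ_inter, walsh, walsh]
  simp only [h]
  rw [← Fintype.prod_sum fun (j : Fin K) (b : ZMod 2) =>
    (if j ∈ A then bitSign b else 1) * if j ∈ B then bitSign b else 1]
  split_ifs with hAB
  · subst hAB
    have : ∀ j : Fin K, ∑ b : ZMod 2,
        ((if j ∈ A then bitSign b else 1) * if j ∈ A then bitSign b else 1) = 2 := by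
      intro j
      split_ifs <;> simp [bitSign_mul_self, ZMod.card]
    rw [Finset.prod_congr rfl fun j _ => this j]
    simp
  · obtain ⟨j, hj⟩ : ∃ j, ¬(j ∈ A ↔ j ∈ B) := by
      by_contra! h
      exact hAB (Finset.ext h)
    refine Finset.prod_eq_zero (Finset.mem_univ j) ?_
    by_cases hA : j ∈ A <;> by_cases hB : j ∈ B <;> simp_all [sum_bitSign]

lemma sum_walsh {A : Finset (Fin K)} (hA : A ≠ ∅) : ∑ y : Obs K, walsh A y = 0 := by
  have := sum_walsh_mul_walsh A ∅
  simpa [walsh, hA] using this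

/-- Parseval's identity for Walsh polynomials. -/
lemma sum_sq_sum_mul_walsh (S : Finset (Finset (Fin K))) (c : Finset (Fin K) → ℝ) :
    ∑ y : Obs K, (∑ A ∈ S, c A * walsh A y) ^ 2 = 2 ^ K * ∑ A ∈ S, c A ^ 2 := by
  have h : ∀ y : Obs K, (∑ A ∈ S, c A * walsh A y) ^ 2 =
      ∑ A ∈ S, ∑ B ∈ S, c A * c B * (walsh A y * walsh B y) := by
    intro y
    rw [sq, Finset.sum_mul_sum]
    refine Finset.sum_congr rfl fun A _ => Finset.sum_congr rfl fun B _ => ?_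
    ring
  simp only [h]
  rw [Finset.sum_comm, Finset.mul_sum]
  refine Finset.sum_congr rfl fun A hA => ?_
  rw [Finset.sum_comm]
  simp only [← Finset.mul_sum, sum_walsh_mul_walsh]
  rw [Finset.sum_eq_single_of_mem A hA fun B _ hB => by simp [hB.symm]]
  simp
  ring

end Characters

/-! ### Tuples of non-deletions. -/

section Tuples

variable {L K : ℕ} (V : Fin K ↪ ZMod L)

lemma comp_mem_tuples {d : ℕ} (e : Fin d → Fin K) : (fun i => V (e i)) ∈ tuples V d := by
  simp [tuples]

lemma sum_tuples {d : ℕ} (f : (Fin d → ZMod L) → ℝ) :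
    ∑ k ∈ tuples V d, f k = ∑ e : Fin d → Fin K, f fun i => V (e i) := by
  symm
  refine Finset.sum_bij (fun e _ i => V (e i)) (fun e _ => comp_mem_tuples V e) ?_ ?_
    fun _ _ => rfl
  · intro e _ e' _ h
    funext i
    exact V.injective (congrFun h i)
  · intro k hk
    simp only [tuples, Fintype.mem_piFinset, Finset.mem_map, Finset.mem_univ, true_and] at hk
    choose e he using hk
    exact ⟨e, Finset.mem_univ _, funext he⟩

end Tuples

/-! ### Walsh coefficients and autocorrelations. -/

section ObservationLaw

variable {L K : ℕ} [NeZero L] (V : Fin K ↪ ZMod L) (ξ : PMF (ZMod L))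

lemma sum_toReal_pmf : ∑ s, (ξ s).toReal = 1 := by
  have h := ξ.tsum_coe
  rw [tsum_fintype] at h
  rw [← ENNReal.toReal_sum fun s _ => ξ.apply_ne_top s, h, ENNReal.toReal_one]

/-- The Walsh coefficients of the noiseless observation law of the signal `x`. -/
noncomputable def walshCoeff (x : Signal L) (A : Finset (Fin K)) : ℝ :=
  ∑ s, (ξ s).toReal * ∏ j ∈ A, bitSign (x (s + V j))

lemma noiseBit_real_singleton (p : I) (b : ZMod 2) :
    (noiseBit p).real {b} = (1 + (1 - 2 * (p : ℝ)) * bitSign b) / 2 := by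
  have hc : ∀ c : ZMod 2, c = 0 ∨ c = 1 := by decide
  rw [noiseBit, bernoulliMeasure, measureReal_def]
  rcases hc b with rfl | rfl
  · simp
    ring
  · simp

lemma obsLaw_singleton (p : I) (x : Signal L) (y : Obs K) :
    obsLaw V ξ p x {y} = ∑ s, ξ s * ∏ j, noiseBit p {y j - x (s + V j)} := by
  have : IsProbabilityMeasure (noiseBit p) := by unfold noiseBit; infer_instance
  have : IsProbabilityMeasure (noiseLaw K p) := by unfold noiseLaw; infer_instance
  rw [obsLaw, Measure.map_apply Measurable.of_discrete (measurableSet_singleton y),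
    Measure.prod_apply (Set.toFinite _).measurableSet, lintegral_fintype]
  refine Finset.sum_congr rfl fun s _ => ?_
  rw [PMF.toMeasure_apply_singleton _ _ (measurableSet_singleton s), mul_comm]
  congr 1
  have hset : Prod.mk s ⁻¹' ((fun sz : ZMod L × Obs K => shiftedCopy V x sz.1 + sz.2) ⁻¹' {y}) =
      {fun j => y j - x (s + V j)} := by
    ext z
    simp only [Set.mem_preimage, Set.mem_singleton_iff]
    refine ⟨fun h => ?_, fun h => ?_⟩
    · rw [← h]
      ext j
      simp [shiftedCopy]
    · rw [h]
      ext j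
      simp [shiftedCopy]
  rw [hset, noiseLaw, Measure.pi_singleton]

/-- The Walsh expansion of the law of an observation. -/
lemma obsLaw_real_singleton (p : I) (x : Signal L) (y : Obs K) :
    (obsLaw V ξ p x).real {y} = (1 / 2) ^ K * ∑ A : Finset (Fin K),
      (1 - 2 * (p : ℝ)) ^ A.card * walsh A y * walshCoeff V ξ x A := by
  have : IsProbabilityMeasure (noiseBit p) := by unfold noiseBit; infer_instance
  rw [measureReal_def, obsLaw_singleton, ENNReal.toReal_sum fun s _ =>
    ENNReal.mul_ne_top (ξ.apply_ne_top s) (ENNReal.prod_ne_top fun j _ => measure_ne_top _ _)]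
  simp only [ENNReal.toReal_mul, ENNReal.toReal_prod, ← measureReal_def, noiseBit_real_singleton,
    CharTwo.sub_eq_add, bitSign_add, walshCoeff, Finset.mul_sum]
  rw [Finset.sum_comm]
  refine Finset.sum_congr rfl fun s _ => ?_
  rw [Finset.prod_div_distrib, Finset.prod_one_add, Finset.powerset_univ, Finset.sum_div,
    Finset.mul_sum]
  refine Finset.sum_congr rfl fun A _ => ?_
  simp only [walsh, Finset.prod_mul_distrib, Finset.prod_const, Finset.card_univ, Fintype.card_fin]
  rw [one_div, inv_pow]
  ring

/-- The autocorrelation of `x` at a set of non-deletions. -/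
noncomputable def setCorr (x : Signal L) (T : Finset (Fin K)) : ℝ :=
  ∑ s, (ξ s).toReal * ∏ j ∈ T, ((x (s + V j)).val : ℝ)

/-- Expand the product of `(-1)^b = 1 - 2b` over `A`. -/
lemma walshCoeff_eq_sum_setCorr (x : Signal L) (A : Finset (Fin K)) :
    walshCoeff V ξ x A = ∑ T ∈ A.powerset, (-2) ^ T.card * setCorr V ξ x T := by
  simp only [walshCoeff, setCorr, Finset.mul_sum]
  rw [Finset.sum_comm]
  refine Finset.sum_congr rfl fun s _ => ?_
  have h : ∀ j, bitSign (x (s + V j)) = 1 + -2 * ((x (s + V j)).val : ℝ) := fun j => by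
    rw [bitSign]
    ring
  simp only [h, Finset.prod_one_add, Finset.mul_sum, Finset.prod_mul_distrib, Finset.prod_const]
  refine Finset.sum_congr rfl fun T _ => ?_
  ring

/-- Entries 0 and 1 are idempotent, so repeated indices collapse. -/
lemma autocorr_comp (x : Signal L) {d : ℕ} (e : Fin d → Fin K) :
    autocorr ξ (fun i => V (e i)) x = setCorr V ξ x (Finset.univ.image e) := by
  have hc : ∀ c : ZMod 2, c = 0 ∨ c = 1 := by decide
  have h1 : (1 : ZMod 2).val = 1 := rfl
  simp only [autocorr, setCorr]
  refine Finset.sum_congr rfl fun s _ => ?_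
  congr 1
  rw [Finset.prod_comp (fun j => ((x (V j + s)).val : ℝ)) e]
  refine Finset.prod_congr rfl fun j hj => ?_
  obtain ⟨i, -, hi⟩ := Finset.mem_image.1 hj
  have hne : (Finset.univ.filter fun i => e i = j).card ≠ 0 :=
    Finset.card_ne_zero_of_mem (Finset.mem_filter.2 ⟨Finset.mem_univ i, hi⟩)
  rw [add_comm]
  rcases hc (x (s + V j)) with h | h <;> simp [h, h1, hne]

variable {V ξ} {x₁ x₂ : Signal L} {t : ℕ}

lemma setCorr_eq_of_card_lt (h : sepOrder V ξ x₁ x₂ = (t : ℕ∞)) {T : Finset (Fin K)}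
    (hT : T.card < t) : setCorr V ξ x₁ T = setCorr V ξ x₂ T := by
  by_contra hne
  have himg : Finset.univ.image (fun i => ((T.equivFin.symm i : T) : Fin K)) = T := by
    ext j
    simp only [Finset.mem_image, Finset.mem_univ, true_and]
    refine ⟨?_, fun hj => ⟨T.equivFin ⟨j, hj⟩, by simp⟩⟩
    rintro ⟨i, rfl⟩
    exact (T.equivFin.symm i).2
  have hle : sepOrder V ξ x₁ x₂ ≤ (T.card : ℕ∞) := by
    refine iInf₂_le (T.card) ⟨_, comp_mem_tuples V fun i => ((T.equivFin.symm i : T) : Fin K), ?_⟩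
    rwa [autocorr_comp, autocorr_comp, himg]
  rw [h, Nat.cast_le] at hle
  omega

lemma one_le_of_sepOrder_eq (h : sepOrder V ξ x₁ x₂ = (t : ℕ∞)) : 1 ≤ t := by
  by_contra ht
  have h1 : (1 : ℕ∞) ≤ sepOrder V ξ x₁ x₂ := by
    refine le_iInf₂ fun d hd => ?_
    obtain ⟨k, -, hk⟩ := hd
    rcases Nat.eq_zero_or_pos d with rfl | hd
    -- An autocorrelation of order 0 is the total mass of `ξ`, whatever the signal.
    · simp [autocorr] at hk
    · exact_mod_cast hd
  rw [h] at h1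
  exact ht (by exact_mod_cast h1)

lemma walshCoeff_sub_of_card_lt (h : sepOrder V ξ x₁ x₂ = (t : ℕ∞)) {A : Finset (Fin K)}
    (hA : A.card < t) : walshCoeff V ξ x₁ A - walshCoeff V ξ x₂ A = 0 := by
  rw [sub_eq_zero, walshCoeff_eq_sum_setCorr, walshCoeff_eq_sum_setCorr]
  refine Finset.sum_congr rfl fun T hT => ?_
  rw [setCorr_eq_of_card_lt h ((Finset.card_le_card (Finset.mem_powerset.1 hT)).trans_lt hA)]

lemma walshCoeff_sub_of_card_eq (h : sepOrder V ξ x₁ x₂ = (t : ℕ∞)) {A : Finset (Fin K)}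
    (hA : A.card = t) : walshCoeff V ξ x₁ A - walshCoeff V ξ x₂ A =
      (-2) ^ t * (setCorr V ξ x₁ A - setCorr V ξ x₂ A) := by
  rw [walshCoeff_eq_sum_setCorr, walshCoeff_eq_sum_setCorr, ← Finset.sum_sub_distrib,
    Finset.sum_eq_single_of_mem A (Finset.mem_powerset_self A), hA, mul_sub]
  intro T hT hne
  have hlt := Finset.card_lt_card (lt_of_le_of_ne (Finset.mem_powerset.1 hT) hne)
  rw [setCorr_eq_of_card_lt h (hA ▸ hlt), sub_self]

/-- A `t`-tuple whose image has `t` elements is a bijection onto it; this is the source of `t!`. -/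
lemma card_filter_image_eq {T : Finset (Fin K)} (hT : T.card = t) :
    (Finset.univ.filter fun e : Fin t → Fin K => Finset.univ.image e = T).card = t.factorial := by
  have hcard : Fintype.card (Fin t ≃ T) = t.factorial := by
    rw [Fintype.card_equiv (Fintype.equivOfCardEq (by simp [hT]))]
    simp
  rw [← hcard, ← Finset.card_univ]
  symm
  refine Finset.card_bij (fun u _ i => (u i : Fin K)) ?_ ?_ ?_
  · intro u _
    refine Finset.mem_filter.2 ⟨Finset.mem_univ _, ?_⟩
    ext j
    simp only [Finset.mem_image, Finset.mem_univ, true_and]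
    refine ⟨?_, fun hj => ⟨u.symm ⟨j, hj⟩, by simp⟩⟩
    rintro ⟨i, rfl⟩
    exact (u i).2
  · intro u _ u' _ h
    ext i
    exact congrArg Fin.val (congrFun h i)
  · intro e he
    have he' := (Finset.mem_filter.1 he).2
    have hmem : ∀ i, e i ∈ T := fun i => he' ▸ Finset.mem_image_of_mem e (Finset.mem_univ i)
    have hbij : Function.Bijective fun i => (⟨e i, hmem i⟩ : T) := by
      rw [Fintype.bijective_iff_surjective_and_card]
      refine ⟨fun j => ?_, by simp [hT]⟩
      obtain ⟨i, -, hi⟩ := Finset.mem_image.1 (he'.symm ▸ j.2 : (j : Fin K) ∈ Finset.univ.image e)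
      exact ⟨i, Subtype.ext hi⟩
    exact ⟨Equiv.ofBijective _ hbij, Finset.mem_univ _, rfl⟩

/-- At the separation order only tuples with distinct entries contribute. -/
lemma sum_tuples_sq_autocorr_sub (h : sepOrder V ξ x₁ x₂ = (t : ℕ∞)) :
    ∑ k ∈ tuples V t, (autocorr ξ k x₁ - autocorr ξ k x₂) ^ 2 =
      t.factorial * ∑ T : Finset (Fin K) with T.card = t,
        (setCorr V ξ x₁ T - setCorr V ξ x₂ T) ^ 2 := by
  rw [sum_tuples]
  simp only [autocorr_comp]
  rw [← Finset.sum_fiberwise Finset.univ fun e : Fin t → Fin K => Finset.univ.image e,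
    Finset.sum_filter, Finset.mul_sum]
  refine Finset.sum_congr rfl fun T _ => ?_
  rw [Finset.sum_congr rfl fun e he => by rw [(Finset.mem_filter.1 he).2], Finset.sum_const,
    nsmul_eq_mul]
  split_ifs with hT
  · rw [card_filter_image_eq hT]
  · rcases lt_or_gt_of_ne hT with hlt | hgt
    · rw [setCorr_eq_of_card_lt h hlt]
      simp
    · rw [Finset.filter_false_of_mem]
      · simp
      · rintro e - rfl
        have := Finset.card_image_le (s := Finset.univ) (f := e)
        rw [Finset.card_univ, Fintype.card_fin] at this
        omega

end ObservationLaw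

/-! ### The low-SNR expansion. -/

section Expansion

variable {L K : ℕ} [NeZero L] {V : Fin K ↪ ZMod L} {ξ : PMF (ZMod L)} {x₁ x₂ : Signal L} {t : ℕ}

lemma tendsto_one_sub_two_mul :
    Tendsto (fun p : I => 1 - 2 * (p : ℝ)) (comap snr (𝓝 0)) (𝓝 0) := by
  refine (tendsto_zero_iff_abs_tendsto_zero _).2 ?_
  have h : ∀ p : I, |1 - 2 * (p : ℝ)| = Real.sqrt (4 * snr p) := by
    intro p
    rw [← Real.sqrt_sq_eq_abs, snr]
    congr 1
    ring
  simp only [Function.comp_def, h]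
  have hc : Tendsto (fun z : ℝ => Real.sqrt (4 * z)) (𝓝 0) (𝓝 0) := by
    have : Continuous fun z : ℝ => Real.sqrt (4 * z) := by fun_prop
    simpa using this.tendsto 0
  exact hc.comp tendsto_comap

/-- The low-noise-ratio expansion of the Chernoff information of two signals. -/
theorem exists_chernoffInfo_eq (h : sepOrder V ξ x₁ x₂ = (t : ℕ∞)) :
    ∃ r : I → ℝ, (r =O[comap snr (𝓝 0)] fun p => snr p ^ (t + 1)) ∧
      ∀ᶠ p in comap snr (𝓝 0),
        chernoffInfo (obsLaw V ξ p x₁) (obsLaw V ξ p x₂) =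
          (((2 : ℝ) ^ (4 * (t : ℤ) - 3) / (t.factorial : ℝ) * snr p ^ t *
            (∑ k ∈ tuples V t, (autocorr ξ k x₁ - autocorr ξ k x₂) ^ 2) + r p : ℝ) : EReal) := by
  set D : Finset (Fin K) → ℝ := fun A => walshCoeff V ξ x₁ A - walshCoeff V ξ x₂ A with hD
  -- `b` is the law of `x₂` as a polynomial in `θ`; `d` is the difference of the two laws divided by
  -- `θ^t`, a polynomial because all lower degrees cancel.
  set b : Obs K → ℝ → ℝ := fun y θ => (1 / 2) ^ K * ∑ A : Finset (Fin K),
    θ ^ A.card * walsh A y * walshCoeff V ξ x₂ A with hb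
  set d : Obs K → ℝ → ℝ := fun y θ => (1 / 2) ^ K * ∑ A : Finset (Fin K) with t ≤ A.card,
    θ ^ (A.card - t) * walsh A y * D A with hd
  have ht := one_le_of_sepOrder_eq h
  have hsum0 : ∀ f : Finset (Fin K) → ℝ,
      ∑ A : Finset (Fin K), (0 : ℝ) ^ A.card * f A = f ∅ := by
    intro f
    rw [Finset.sum_eq_single ∅ (fun A _ hA => by simp [hA]) (by simp)]
    simp
  have hw0 : ∀ x : Signal L, walshCoeff V ξ x ∅ = 1 := fun x => by
    simp [walshCoeff, sum_toReal_pmf]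
  have hb0 : ∀ y, b y 0 = (1 / 2) ^ K := by
    intro y
    simp only [hb, mul_assoc, hsum0]
    simp [walsh, hw0]
  have hd0 : ∀ y, d y 0 = (1 / 2) ^ K * ∑ A : Finset (Fin K) with A.card = t,
      D A * walsh A y := by
    intro y
    simp only [hd]
    congr 1
    rw [Finset.sum_filter, Finset.sum_filter]
    refine Finset.sum_congr rfl fun A _ => ?_
    rcases lt_trichotomy A.card t with hlt | heq | hgt
    · rw [if_neg (by omega), if_neg (by omega)]
    · rw [if_pos heq.ge, if_pos heq, heq, Nat.sub_self, pow_zero]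
      ring
    · rw [if_pos hgt.le, if_neg (by omega), zero_pow (by omega)]
      ring
  have hab : ∀ (p : I) (y : Obs K), (obsLaw V ξ p x₁).real {y} =
      b y (1 - 2 * (p : ℝ)) + (1 - 2 * (p : ℝ)) ^ t * d y (1 - 2 * (p : ℝ)) := by
    intro p y
    rw [obsLaw_real_singleton]
    generalize 1 - 2 * (p : ℝ) = θ
    simp only [hb, hd]
    rw [mul_left_comm, ← mul_add, Finset.sum_filter, Finset.mul_sum (a := θ ^ t), ← Finset.sum_add_distrib]
    congr 1
    refine Finset.sum_congr rfl fun A _ => ?_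
    split_ifs with hA
    · rw [show θ ^ t * (θ ^ (A.card - t) * walsh A y * D A) =
        (θ ^ t * θ ^ (A.card - t)) * walsh A y * D A by ring, ← pow_add, Nat.add_sub_cancel' hA]
      simp only [hD]
      ring
    · have := sub_eq_zero.1 (walshCoeff_sub_of_card_lt h (not_le.1 hA))
      rw [this]
      ring
  obtain ⟨M, hM⟩ := exists_iInf_log_eq (b := b) (d := d) (τ := Equiv.addRight (1 : Obs K)) ht
    (fun y => by simp only [hb]; fun_prop) (fun y => by simp only [hd]; fun_prop)
    (fun y => by rw [hb0]; positivity)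
    (fun y θ => by
      simp only [hb, Equiv.coe_addRight, walsh_add_one]
      congr 1
      refine Finset.sum_congr rfl fun A _ => ?_
      rw [neg_pow]
      ring)
    (fun y θ => by
      simp only [hd, Equiv.coe_addRight, walsh_add_one]
      rw [mul_left_comm, Finset.mul_sum (a := (-1 : ℝ) ^ t)]
      congr 1
      refine Finset.sum_congr rfl fun A hA => ?_
      have hA' := (Finset.mem_filter.1 hA).2
      have hpow : (-1 : ℝ) ^ t * (-1) ^ A.card = (-1) ^ (A.card - t) := by
        rw [← pow_add, show t + A.card = A.card - t + 2 * t by omega, pow_add, pow_mul]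
        simp
      rw [neg_pow, ← hpow]
      ring)
    (fun θ => by
      simp only [hb]
      rw [← Finset.mul_sum, Finset.sum_comm, Finset.sum_eq_single ∅]
      · simp [walsh, hw0, ZMod.card]
      · intro A _ hA
        rw [← Finset.sum_mul, ← Finset.mul_sum, sum_walsh hA]
        ring
      · simp)
    (fun θ => by
      simp only [hd]
      rw [← Finset.mul_sum, Finset.sum_comm, Finset.sum_eq_zero, mul_zero]
      intro A hA
      have hA' := (Finset.mem_filter.1 hA).2
      have hne : A ≠ ∅ := by
        rintro rfl
        simp at hA'
        omega
      rw [← Finset.sum_mul, ← Finset.mul_sum, sum_walsh hne]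
      ring)
  -- At `θ = 0` the law `b` is uniform and only degree `t` survives in `d`. Parseval's `2^K` cancels
  -- the normalization, and `4^t` is the square of the top coefficient `(-2)^t`.
  have hE : ∑ y, d y 0 ^ 2 / b y 0 =
      4 ^ t / t.factorial * ∑ k ∈ tuples V t, (autocorr ξ k x₁ - autocorr ξ k x₂) ^ 2 := by
    have h1 : ∀ y, d y 0 ^ 2 / b y 0 =
        (1 / 2) ^ K * (∑ A : Finset (Fin K) with A.card = t, D A * walsh A y) ^ 2 := by
      intro y
      rw [hd0, hb0]
      field_simp
    have hD4 : ∑ A : Finset (Fin K) with A.card = t, D A ^ 2 =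
        4 ^ t * ∑ A : Finset (Fin K) with A.card = t,
          (setCorr V ξ x₁ A - setCorr V ξ x₂ A) ^ 2 := by
      rw [Finset.mul_sum]
      refine Finset.sum_congr rfl fun A hA => ?_
      simp only [hD]
      rw [walshCoeff_sub_of_card_eq h (Finset.mem_filter.1 hA).2, mul_pow, ← pow_mul,
        mul_comm t 2, pow_mul]
      norm_num
    simp only [h1]
    rw [← Finset.mul_sum, sum_sq_sum_mul_walsh, ← mul_assoc, ← mul_pow, hD4,
      sum_tuples_sq_autocorr_sub h]
    have : (t.factorial : ℝ) ≠ 0 := by exact_mod_cast t.factorial_ne_zero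
    field_simp
    simp
  set S := ∑ k ∈ tuples V t, (autocorr ξ k x₁ - autocorr ξ k x₂) ^ 2 with hS
  set main : I → ℝ := fun p => (2 : ℝ) ^ (4 * (t : ℤ) - 3) / (t.factorial : ℝ) * snr p ^ t * S
    with hmain
  have hev : ∀ᶠ p in comap snr (𝓝 0), ∃ r : ℝ, |r| ≤ M * 4 ^ (t + 1) * snr p ^ (t + 1) ∧
      chernoffInfo (obsLaw V ξ p x₁) (obsLaw V ξ p x₂) = ((main p + r : ℝ) : EReal) := by
    filter_upwards [tendsto_one_sub_two_mul.eventually hM] with p ⟨r, hr, hJ⟩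
    have hθ : ∀ n, (1 - 2 * (p : ℝ)) ^ (2 * n) = 4 ^ n * snr p ^ n := by
      intro n
      rw [pow_mul, ← mul_pow, snr]
      congr 1
      ring
    refine ⟨r, ?_, ?_⟩
    · rwa [show 2 * t + 2 = 2 * (t + 1) by ring, hθ, ← mul_assoc] at hr
    · have hm : (∑ y, d y 0 ^ 2 / b y 0) / 8 * (1 - 2 * (p : ℝ)) ^ (2 * t) = main p := by
        rw [hE, hθ, hmain]
        -- One `4^t` comes from the Walsh coefficients, one from `θ^(2t) = 4^t SNR^t`, and the 8
        -- from `l = 1/2`.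
        have h2 : (2 : ℝ) ^ (4 * (t : ℤ) - 3) = 4 ^ t * 4 ^ t / 8 := by
          rw [zpow_sub₀ two_ne_zero, zpow_mul, zpow_natCast, ← mul_pow]
          norm_num
        simp only [h2]
        ring
      rw [hm] at hJ
      rw [← hJ, chernoffInfo]
      simp only [← hab]
      have hb2 : ∀ y, b y (1 - 2 * (p : ℝ)) = (obsLaw V ξ p x₂).real {y} := fun y =>
        (obsLaw_real_singleton V ξ p x₂ y).symm
      have hreal : ∀ x y, ENNReal.ofReal ((obsLaw V ξ p x).real {y}) = obsLaw V ξ p x {y} :=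
        fun x y => ofReal_measureReal
      simp only [hb2, hreal]
  refine ⟨fun p => (chernoffInfo (obsLaw V ξ p x₁) (obsLaw V ξ p x₂)).toReal - main p,
    IsBigO.of_bound (M * 4 ^ (t + 1)) ?_, ?_⟩
  · filter_upwards [hev] with p ⟨r, hr, hC⟩
    have hs : 0 ≤ snr p := sq_nonneg _
    rw [hC, EReal.toReal_coe, add_sub_cancel_left, Real.norm_eq_abs, Real.norm_eq_abs,
      abs_of_nonneg (pow_nonneg hs _)]
    exact hr
  · filter_upwards [hev] with p ⟨r, hr, hC⟩
    rw [hC, EReal.toReal_coe, add_sub_cancel]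

end Expansion

end BMA

theorem theorem1 {L K : ℕ} [NeZero L] (V : Fin K ↪ ZMod L) (ξ : PMF (ZMod L))
    (π : PMF (BMA.Signal L)) (hπ : π.support.Nontrivial) :
    (∀ (p : I) (g : ∀ N : ℕ, (Fin N → BMA.Obs K) → BMA.Signal L),
      (∀ N, BMA.IsMAP V ξ p π N (g N)) →
      ∃ m : EReal,
        IsLeast {c : EReal | ∃ x₁ ∈ π.support, ∃ x₂ ∈ π.support, x₁ ≠ x₂ ∧
          c = BMA.chernoffInfo (BMA.obsLaw V ξ p x₁) (BMA.obsLaw V ξ p x₂)} m ∧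
        Tendsto (fun N : ℕ => (((1 / (N : ℝ) : ℝ)) : EReal) *
          ENNReal.log (BMA.errorProb V ξ p π N (g N))) atTop (𝓝 (-m))) ∧
    (∀ x₁ ∈ π.support, ∀ x₂ ∈ π.support, x₁ ≠ x₂ →
      ∀ t : ℕ, BMA.sepOrder V ξ x₁ x₂ = (t : ℕ∞) →
      ∃ r : I → ℝ,
        (r =O[comap BMA.snr (𝓝 0)] fun p => BMA.snr p ^ (t + 1)) ∧
        ∀ᶠ p in comap BMA.snr (𝓝 0),
          BMA.chernoffInfo (BMA.obsLaw V ξ p x₁) (BMA.obsLaw V ξ p x₂) =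
            (((2 : ℝ) ^ (4 * (t : ℤ) - 3) / (t.factorial : ℝ) * BMA.snr p ^ t *
              (∑ k ∈ BMA.tuples V t, (BMA.autocorr ξ k x₁ - BMA.autocorr ξ k x₂) ^ 2) +
              r p : ℝ) : EReal)) := by
  exact ⟨fun p g hg => BMA.tendsto_log_errorProb V ξ p π hπ g hg,
    fun _ _ _ _ _ _ ht => BMA.exists_chernoffInfo_eq ht⟩
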